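/- **Setting.** Let $(\mathcal M,d)$ be a metric space, $\mathcal X\subset\mathcal M$ finite, $n=|\mathcal X|\ge 2$, and $q\in\mathcal M$ a query point with a unique nearest neighbour $x_q\in\mathcal X$; let $x_{q'}$ be a second nearest neighbour, i.e. a point of $\mathcal X\setminus\{x_q\}$ closest to $q$, and $d_{\min}=\min_{x\ne y\in\mathcal X}d(x,y)$. Put $R=\max\{[d(q,x_q)-d(q,x_{q'})]^{-2},\,d_{\min}^{-2}\}$. Let $c$ be the expansion constant of $\mathcal S=\mathcal X\cup\{q\}$: the smallest $c\ge2$ with $|\mathcal S\cap B(x,2r)|\le c\,|\mathcal S\cap B(x,r)|$ for all $x\in\mathcal S$, $r>0$ (closed balls). Distances are accessed only through an oracle: each query of a pair $(q,x)$ returns $d(q,x)+\eta$ with fresh independent zero-mean noise $\eta$ that is sub-Gaussian with scale $1$. A *cover tree* on $\mathcal X$ consists of sets $C_i\subset\mathcal X$ ($i\in\mathbb Z$), a single root point at some level $i_{\rm top}$ and $C_{i_{\rm bot}}=\mathcal X$ for some $i_{\rm bot}\le i_{\rm top}$, such that $C_i\subset C_{i-1}$; every $p\in C_{i-1}$ has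 one parent in $C_i$, at distance at most $2^i$, which is $p$ itself if $p\in C_i$; and distinct points of $C_i$ are at distance greater than $2^i$. A node of $C_{i-1}$ is *explicit* if it is not in $C_i$ and *implicit* otherwise. **Algorithm.** Write $C_\delta(t)=\sqrt{4\log(\log_2(2t)/\delta)/t}$, let $T_j$ be the number of queries of $(q,j)$ made in the current subroutine call and $\hat d_j$ their empirical mean. Ties in $\arg\min$, $\arg\max$ are broken by an arbitrary fixed rule. *Identify-Cover*$(Q,\delta',i)$: query every $j\in Q$ once. With $w_j=C_{\delta'/|Q|}(T_j)$ set $U=\min_{k\in Q}(\hat d_k+w_k)+2^i$, $L=\min_{k\in Q}(\hat d_k-w_k)+2^i+2^{i-1}$, $\hat G=\{j\in Q:\hat d_j\le\min_k\hat d_k+2^i\}$ and $K=\{j\in Q:\hat d_j-w_j>U\text{ or }\hat d_j+w_j<L\}$. While $K\ne Q$, query $j_1=\arg\min_{\hat G\setminus K}(\hat d_j+w_j)$, $j_2=\arg\max_{(Q\setminus\hat G)\setminus K}(\hat d_j-w_j)$ (if these sets are nonempty) and $j^*=\arg\min_Q(\hat d_j-w_j)$, and update all quantities. Return $\{j\in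 Q:\hat d_j+w_j<L\}$. *find-smallest-in-set*$(Q,\delta')$: if $|Q|=1$ return its element. Otherwise query every $j\in Q$ once; with $w_j=C_{\delta'/n}(T_j)$ let $K=\{j\in Q:\hat d_j-w_j>\min_{k\in Q}(\hat d_k+w_k)\}$; while $|Q\setminus K|>1$, query all $j\in Q\setminus K$ and update. Return the element of $Q\setminus K$. *Noisy-Find-Nearest* ($c$ unknown): let $\alpha=n+1$ and $Q_{i_{\rm top}}=C_{i_{\rm top}}$. For $i=i_{\rm top},i_{\rm top}-1,\dots,i_{\rm bot}+1$ let $Q\subset C_{i-1}$ be the set of the children of the nodes of $Q_i$. If $Q$ contains an explicit node (equivalently $Q\ne Q_i$), put $Q_{i-1}=$ Identify-Cover$(Q,\delta/\alpha,i)$; if all nodes of $Q$ are implicit, put $Q_{i-1}=Q_i$ without calling the oracle. Return find-smallest-in-set$(Q_{i_{\rm bot}},\delta/\alpha)$. **The parameter $\kappa$.** For a call of Identify-Cover on $(Q,i)$ put $d(q,Q)=\min_{j\in Q}d(q,j)$, $\kappa_i=\min_{j\in Q}|d(q,Q)+2^i-d(q,j)|$, and let $\kappa_i^{\rm avg}$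 be the average over $j\in Q$ of $$\min\Big\{\max\Big\{\tfrac1{(d(q,Q)+2^i-d(q,j))^2},\tfrac1{(d(q,j)+\kappa_i-d(q,Q))^2}\Big\},\,2^{-2i}\Big\}\qquad(1/0=\infty).$$ Let $\overline\kappa$ be the average of $\kappa_i^{\rm avg}$ over the calls of Identify-Cover made in the run, let $\kappa'=\frac1{|Q_{i_{\rm bot}}|}\sum_{j\in Q_{i_{\rm bot}}\setminus\{x_q\}}(d(q,x_q)-d(q,j))^{-2}$, and $\kappa=\max\{1,\overline\kappa,\kappa'\}$. **Theorem.** There are universal constants $A,B>0$ such that for every $0<\delta<1/2$, every cover tree on $\mathcal X$ and every such $q$, with probability at least $1-\delta$ Noisy-Find-Nearest terminates, returns the nearest neighbour $x_q$ of $q$, makes at most $$A\,c^{17}\,\log(n)\,\log\!\Big(\frac n\delta\,\log(e+R)\Big)\,\kappa$$ calls to the oracle, and $$\kappa\le B\max\{1,R\}=B\max\big\{1,\,[d(q,x_q)-d(q,x_{q'})]^{-2},\,d_{\min}^{-2}\big\}.$$ That is, the number of calls is $O(c^{17}\log(n)\log(n/\delta)\,\kappa)$ up to a doubly logarithmic term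 in the inverse gaps. -/

import Mathlib

open MeasureTheory ProbabilityTheory

universe u v

noncomputable section

namespace BanditCoverTree

/-! ### Geometry: expansion constant and cover trees -/

/-- The expansion constant of a (finite) set `S`: the smallest `c ≥ 2` such that
`|S ∩ B(x, 2r)| ≤ c |S ∩ B(x, r)|` for all `x ∈ S` and `r > 0`. -/
def expansionConst {M : Type u} [MetricSpace M] (S : Set M) : ℝ :=
  sInf {c : ℝ | 2 ≤ c ∧ ∀ x ∈ S, ∀ r : ℝ, 0 < r →
    ((S ∩ Metric.closedBall x (2 * r)).ncard : ℝ) ≤ c * ((S ∩ Metric.closedBall x r).ncard : ℝ)}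

/-- A cover tree on the finite set `X`. `level i` is the set `C_i` of nodes at level `i`, and
`parent i p` is the parent in `C_i` of the node `p ∈ C_{i-1}`. The levels are indexed by all
integers; `top` and `bot` are recorded levels at and above which there is only the root, and at
and below which every point of `X` is a node. -/
structure CoverTree {M : Type u} [MetricSpace M] (X : Finset M) where
  level : ℤ → Finset M
  parent : ℤ → M → M
  top : ℤ
  bot : ℤ
  bot_le_top : bot ≤ top
  level_subset : ∀ i, level i ⊆ X
  level_top : ∃ r, level top = {r}
  level_bot : level bot = X
  nesting : ∀ i, level i ⊆ level (i - 1)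
  parent_mem : ∀ i, ∀ p ∈ level (i - 1), parent i p ∈ level i
  covering : ∀ i, ∀ p ∈ level (i - 1), dist p (parent i p) ≤ (2 : ℝ) ^ i
  parent_self : ∀ i, ∀ p ∈ level i, parent i p = p
  separation : ∀ i, ∀ p ∈ level i, ∀ p' ∈ level i, p ≠ p' → (2 : ℝ) ^ i < dist p p'

open Classical in
/-- `⋃_{p ∈ Q} children(p)` for a set `Q` of nodes of level `i`. A node that is present at both
levels `i` and `i - 1` is its own parent, so it is one of its own children. -/
def CoverTree.childrenOf {M : Type u} [MetricSpace M] {X : Finset M} (T : CoverTree X) (i : ℤ)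
    (Q : Finset M) : Finset M :=
  (T.level (i - 1)).filter (fun p => T.parent i p ∈ Q)

/-! ### The stochastic distance oracle -/

/-- The answers of the stochastic distance oracle to queries of pairs `(q, x)` with `x ∈ X`.
`Y k x s` is the answer to the `(s+1)`-st query of `(q, x)` that is made while stage `k` of the
search is running. Distinct queries read distinct entries of the table, whose entries are all
independent and equal to `d(q, x)` plus zero-mean noise that is sub-Gaussian with scale `1`. -/
structure IsDistanceOracle {M : Type u} [MetricSpace M] {Ω : Type v} [MeasurableSpace Ω]
    (μ : Measure Ω) (X : Finset M) (q : M) (Y : ℕ → M → ℕ → Ω → ℝ) : Prop where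
  measurable : ∀ k, ∀ x ∈ X, ∀ s, Measurable (Y k x s)
  indep : iIndepFun (fun z : ℕ × {x // x ∈ X} × ℕ => Y z.1 z.2.1 z.2.2) μ
  zero_mean : ∀ k, ∀ x ∈ X, ∀ s, ∫ ω, (Y k x s ω - dist q x) ∂μ = 0
  subGaussian : ∀ k, ∀ x ∈ X, ∀ s, HasSubgaussianMGF (fun ω => Y k x s ω - dist q x) 1 μ

/-! ### Empirical means and confidence widths

In this part `y x s` are the oracle answers for the point `x` in one subroutine call and
`T x` is the number of queries of `x` made so far in that call. -/

/-- The anytime confidence width `C_δ(t) = √(4 log(log₂(2t)/δ) / t)`. -/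
def confWidth (δ : ℝ) (t : ℕ) : ℝ :=
  √(4 * Real.log (Real.logb 2 (2 * t) / δ) / t)

def empMean {M : Type u} (y : M → ℕ → ℝ) (T : M → ℕ) (j : M) : ℝ :=
  (∑ s ∈ Finset.range (T j), y j s) / T j

def ucb {M : Type u} (δ : ℝ) (y : M → ℕ → ℝ) (T : M → ℕ) (j : M) : ℝ :=
  empMean y T j + confWidth δ (T j)

def lcb {M : Type u} (δ : ℝ) (y : M → ℕ → ℝ) (T : M → ℕ) (j : M) : ℝ :=
  empMean y T j - confWidth δ (T j)

/-- `min_{k ∈ S} f k` (for a nonempty finite set `S`). -/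
def minOver {M : Type u} (S : Finset M) (f : M → ℝ) : ℝ :=
  sInf (f '' (S : Set M))

open Classical in
/-- The set of all minimizers of `f` on `S`. -/
def argminSet {M : Type u} (S : Finset M) (f : M → ℝ) : Finset M :=
  S.filter (fun j => ∀ k ∈ S, f j ≤ f k)

/-- The set of all maximizers of `f` on `S`. -/
def argmaxSet {M : Type u} (S : Finset M) (f : M → ℝ) : Finset M :=
  argminSet S (fun j => -f j)

open Classical in
/-- Query once the element of `S` that the tie-breaking rule `sel` picks; do nothing if `S` is
empty. -/
def pullFrom {M : Type u} (sel : Finset M → M) (S : Finset M) (T : M → ℕ) : M → ℕ :=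
  if S.Nonempty then Function.update T (sel S) (T (sel S) + 1) else T

open Classical in
/-- Iterate `step` from `s` until `done` holds; `none` if this never happens. -/
def whileLoop {σ : Type u} (done : σ → Prop) (step : σ → σ) (s : σ) : Option σ :=
  if h : ∃ t : ℕ, done (step^[t] s) then some (step^[Nat.find h] s) else none

/-! ### Identify-Cover

`δ` is the failure probability given to the call; the widths are `C_{δ/|Q|}`. -/

/-- `U_t = min_k (upper confidence bound of k) + 2^i`. -/
def icUpper {M : Type u} (δ : ℝ) (Q : Finset M) (i : ℤ) (y : M → ℕ → ℝ) (T : M → ℕ) : ℝ :=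
  minOver Q (ucb (δ / Q.card) y T) + (2 : ℝ) ^ i

/-- `L_t = min_k (lower confidence bound of k) + 2^i + 2^(i-1)`. -/
def icLower {M : Type u} (δ : ℝ) (Q : Finset M) (i : ℤ) (y : M → ℕ → ℝ) (T : M → ℕ) : ℝ :=
  minOver Q (lcb (δ / Q.card) y T) + (2 : ℝ) ^ i + (2 : ℝ) ^ (i - 1)

open Classical in
/-- The set `K` of known points. -/
def icKnown {M : Type u} (δ : ℝ) (Q : Finset M) (i : ℤ) (y : M → ℕ → ℝ) (T : M → ℕ) :
    Finset M :=
  Q.filter (fun j => icUpper δ Q i y T < lcb (δ / Q.card) y T j ∨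
    ucb (δ / Q.card) y T j < icLower δ Q i y T)

open Classical in
/-- The empirical cover set `Ĝ`. -/
def icEmpCover {M : Type u} (Q : Finset M) (i : ℤ) (y : M → ℕ → ℝ) (T : M → ℕ) : Finset M :=
  Q.filter (fun j => empMean y T j ≤ minOver Q (empMean y T) + (2 : ℝ) ^ i)

open Classical in
/-- One round of the loop: query `j₁`, `j₂` (if they exist) and `j*`, all three chosen from the
counts `T` at the start of the round. -/
def icStep {M : Type u} (sel : Finset M → M) (δ : ℝ) (Q : Finset M) (i : ℤ) (y : M → ℕ → ℝ)
    (T : M → ℕ) : M → ℕ :=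
  let K := icKnown δ Q i y T
  let G := icEmpCover Q i y T
  let S₁ := argminSet (G \ K) (ucb (δ / Q.card) y T)
  let S₂ := argmaxSet ((Q \ G) \ K) (lcb (δ / Q.card) y T)
  let S₃ := argminSet Q (lcb (δ / Q.card) y T)
  pullFrom sel S₃ (pullFrom sel S₂ (pullFrom sel S₁ T))

open Classical in
/-- Identify-Cover: the returned set and the number of oracle calls, `none` if it runs forever. -/
def identifyCover {M : Type u} (sel : Finset M → M) (δ : ℝ) (Q : Finset M) (i : ℤ)
    (y : M → ℕ → ℝ) : Option (Finset M × ℕ) :=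
  (whileLoop (fun T => icKnown δ Q i y T = Q) (icStep sel δ Q i y) (fun _ => 1)).map
    (fun T => (Q.filter (fun j => ucb (δ / Q.card) y T j < icLower δ Q i y T), ∑ j ∈ Q, T j))

/-! ### find-smallest-in-set -/

open Classical in
/-- `Q \ K`, where `K` is the set of the points whose lower confidence bound exceeds the smallest
upper confidence bound; the widths are `C_{δ/n}`. -/
def fsActive {M : Type u} (n : ℕ) (δ : ℝ) (Q : Finset M) (y : M → ℕ → ℝ) (T : M → ℕ) :
    Finset M :=
  Q.filter (fun j => ¬ minOver Q (ucb (δ / n) y T) < lcb (δ / n) y T j)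

open Classical in
def fsStep {M : Type u} (n : ℕ) (δ : ℝ) (Q : Finset M) (y : M → ℕ → ℝ) (T : M → ℕ) : M → ℕ :=
  fun j => if j ∈ fsActive n δ Q y T then T j + 1 else T j

open Classical in
/-- find-smallest-in-set: the returned point and the number of oracle calls, `none` if it runs
forever. -/
def findSmallest {M : Type u} (sel : Finset M → M) (n : ℕ) (δ : ℝ) (Q : Finset M)
    (y : M → ℕ → ℝ) : Option (M × ℕ) :=
  if Q.card = 1 then some (sel Q, 0)
  else (whileLoop (fun T => (fsActive n δ Q y T).card ≤ 1) (fsStep n δ Q y) (fun _ => 1)).map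
    (fun T => (sel (fsActive n δ Q y T), ∑ j ∈ Q, T j))

/-! ### Noisy-Find-Nearest (with unknown expansion constant) -/

/-- State of the descent: the current cover set, the number of oracle calls so far, and the
list of the pairs `(i, Q)` on which Identify-Cover has been called. -/
structure SearchState (M : Type u) where
  cover : Finset M
  calls : ℕ
  trace : List (ℤ × Finset M)

/-- The family-wise correction `α = n + 1`, used when the expansion constant is unknown. -/
def alpha {M : Type u} (X : Finset M) : ℝ := X.card + 1

open Classical in
/-- The descent after `k` levels. Stage `k` works on level `i = top - k`: it expands
`Q = ⋃_{p ∈ Q_i} children(p)` and computes `Q_{i-1}` by Identify-Cover with failure probability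
`δ / α`. If `Q = Q_i`, i.e. if all nodes of `Q` are implicit at level `i - 1`, then this level is
not stored for `Q_i`; the cover set is kept and the oracle is not called. -/
def descend {M : Type u} [MetricSpace M] {X : Finset M} (sel : Finset M → M) (T : CoverTree X)
    (δ : ℝ) (y : ℕ → M → ℕ → ℝ) : ℕ → Option (SearchState M)
  | 0 => some ⟨T.level T.top, 0, []⟩
  | k + 1 => (descend sel T δ y k).bind fun s =>
      let i : ℤ := T.top - k
      let Q := T.childrenOf i s.cover
      if Q = s.cover then some s
      else (identifyCover sel (δ / alpha X) Q i (y k)).map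
        fun r => ⟨r.1, s.calls + r.2, (i, Q) :: s.trace⟩

/-- Result of a terminating run: the returned point, the total number of oracle calls, the pairs
`(i, Q)` on which Identify-Cover was called, and the final cover set. -/
structure SearchResult (M : Type u) where
  answer : M
  calls : ℕ
  trace : List (ℤ × Finset M)
  finalCover : Finset M

/-- Noisy-Find-Nearest; `none` if the run does not terminate. -/
def noisyFindNearest {M : Type u} [MetricSpace M] {X : Finset M} (sel : Finset M → M)
    (T : CoverTree X) (δ : ℝ) (y : ℕ → M → ℕ → ℝ) : Option (SearchResult M) :=
  let h := (T.top - T.bot).toNat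
  (descend sel T δ y h).bind fun s =>
    (findSmallest sel X.card (δ / alpha X) s.cover (y h)).map
      fun r => ⟨r.1, s.calls + r.2, s.trace, s.cover⟩

/-! ### The noise parameter `κ` -/

/-- `κ_i = min_{j ∈ Q} |d(q, Q) + 2^i - d(q, j)|`. -/
def kappaMargin {M : Type u} [MetricSpace M] (q : M) (i : ℤ) (Q : Finset M) : ℝ :=
  minOver Q (fun j => |minOver Q (dist q) + (2 : ℝ) ^ i - dist q j|)

/-- `min {max {(d(q,Q) + 2^i - d(q,j))⁻², (d(q,j) + κ_i - d(q,Q))⁻²}, 2^(-2i)}`, written as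
`max {min {|·|, |·|}, 2^i}⁻²` so that `0⁻² = ∞` is treated correctly. -/
def kappaTerm {M : Type u} [MetricSpace M] (q : M) (i : ℤ) (Q : Finset M) (j : M) : ℝ :=
  ((max (min |minOver Q (dist q) + (2 : ℝ) ^ i - dist q j|
    |dist q j + kappaMargin q i Q - minOver Q (dist q)|) ((2 : ℝ) ^ i)) ^ 2)⁻¹

/-- Average of the terms over `j ∈ Q`. -/
def kappaAvg {M : Type u} [MetricSpace M] (q : M) (i : ℤ) (Q : Finset M) : ℝ :=
  (∑ j ∈ Q, kappaTerm q i Q j) / Q.card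

/-- `κ̄`: the average of `kappaAvg` over the calls of Identify-Cover. -/
def kappaBar {M : Type u} [MetricSpace M] (q : M) (tr : List (ℤ × Finset M)) : ℝ :=
  (tr.map (fun p => kappaAvg q p.1 p.2)).sum / tr.length

open Classical in
/-- `κ'`: the average over the final cover set of `(d(q, x_q) - d(q, x_j))⁻²`, `j ≠ x_q`. -/
def kappaFinal {M : Type u} [MetricSpace M] (q xq : M) (Q : Finset M) : ℝ :=
  (∑ j ∈ Q.erase xq, ((dist q xq - dist q j) ^ 2)⁻¹) / Q.card

/-- `κ = max {1, κ̄, κ'}` of a run; the `1` accounts for the single query that every point needs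
even without noise. -/
def kappa {M : Type u} [MetricSpace M] (q xq : M) (r : SearchResult M) : ℝ :=
  max 1 (max (kappaBar q r.trace) (kappaFinal q xq r.finalCover))

/-- `max {(d(q, x_q) - d(q, x_{q'}))⁻², d_min⁻²}`, where `d_min` is the smallest distance between
two distinct points of `X`. -/
def worstGap {M : Type u} [MetricSpace M] (X : Finset M) (q xq xq' : M) : ℝ :=
  max ((dist q xq - dist q xq') ^ 2)⁻¹ ((Set.infsep (X : Set M)) ^ 2)⁻¹

end BanditCoverTree

end

/-!
The proof runs the algorithm on the event that every confidence interval that is ever formed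
holds the true distance, and shows that this event has probability at least `1 - δ`.

*Probability.* The width `C_δ(t)` is a law-of-the-iterated-logarithm bound. On each block `4 ^ b
≤ t ≤ 4 ^ (b + 1)` the boundary `t C_δ(t)` is compared with a line, and Ville's inequality for an
exponential martingale bounds the probability to cross it (`measure_block`); the sum over the
blocks is at most `δ` because all the failure probabilities in use are at most `1 / 12`
(`measure_exists_abs_gt_confWidth`). The set `Q` on which Identify-Cover is called, and with it
the width, is random; it is determined by earlier stages, whose answers are independent of those
used in the call, so the union bound can be done for each value of `Q`
(`measure_not_stageValid_le`). Only levels at which the tree has an explicit node can lead to a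
call. There are at most `n - 1` of them, hence the correction `α = n + 1` suffices
(`measure_valid_ge`).

*Correctness.* With valid widths Identify-Cover keeps all points within `2 ^ i` of the minimum
and nothing beyond `2 ^ i + 2 ^ (i - 1)` (`identifyCover_spec`). Since the ancestor of the
nearest neighbour at level `i - 1` is within `2 ^ i` of it, these ancestors are never lost
(`exists_descentInv`), and the last subroutine picks out the nearest neighbour
(`findSmallest_spec`).

*Queries per call.* Each round of Identify-Cover queries some point whose interval is wide
compared with the larger of `2 ^ i` and its excess distance (`exists_wide_query`). So a call
needs `O(log / g ^ 2)` queries per point, `g` being that scale, and `g ^ (-2)` is at most the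
term `kappaTerm` of that point.

*Number of calls.* A cover set has at most `c ^ 5` points and `c ^ 9` children, by packing. The
number of calls is `O(c ^ 2 log n)` (`trace_length_le`): each call comes with an explicit node
and its parent, one of which is not closer to `q` than a fixed fraction of `2 ^ i`, while the
distance of both is at most comparable with the scale of the previous call. Such a point makes
the balls about `q` grow by a factor `1 + c⁻²` (`ncard_closedBall_growth`), which can happen only
`O(c ^ 2 log n)` times on disjoint ranges of radii. Calls at scales far below the distance from
`q` to the nearest neighbour escape this argument, but their explicit nodes are distinct points
of a ball that has at most `c ^ 2` points. Altogether the number of queries is `O(c ^ 11 log n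
log(n/δ log(e + R)) κ)`.
-/

namespace BanditCoverTree

/-! ### Sample complexity of the confidence width -/

/-- A number of samples after which the width `C_δ` stays below `ρ`. -/
noncomputable def sampleBound (δ ρ : ℝ) : ℕ :=
  ⌈32 * (1 + (ρ ^ 2)⁻¹) * Real.log (Real.log (Real.exp 1 + (ρ ^ 2)⁻¹) / δ)⌉₊

lemma one_le_log_exp_one_add {a : ℝ} (ha : 0 ≤ a) : 1 ≤ Real.log (Real.exp 1 + a) := by
  have := Real.log_le_log (Real.exp_pos 1) (le_add_of_nonneg_right ha)
  rwa [Real.log_exp] at this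

lemma two_le_log_twelve : 2 ≤ Real.log 12 := by
  rw [Real.le_log_iff_exp_le (by norm_num)]
  have h := Real.exp_one_lt_d9
  have h2 : Real.exp 2 = Real.exp 1 * Real.exp 1 := by rw [← Real.exp_add]; norm_num
  rw [h2]
  nlinarith [Real.exp_pos 1]

lemma two_le_log_div {δ L : ℝ} (hδ : 0 < δ) (hδ' : δ ≤ 1 / 12) (hL : 1 ≤ L) :
    2 ≤ Real.log (L / δ) := by
  refine two_le_log_twelve.trans (Real.log_le_log (by norm_num) ?_)
  rw [le_div_iff₀ hδ]
  nlinarith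

lemma log_two_ge : (2 : ℝ) / 3 ≤ Real.log 2 := by
  have := Real.log_two_gt_d9; linarith

lemma logb_two_le {s : ℝ} (hs : 64 ≤ s) : Real.logb 2 s ≤ s / 8 := by
  have h64 : Real.log 64 = 6 * Real.log 2 := by
    rw [show (64 : ℝ) = 2 ^ 6 by norm_num, Real.log_pow]; norm_num
  have h1 : Real.log s = Real.log 64 + Real.log (s / 64) := by
    rw [Real.log_div (by linarith) (by norm_num)]; ring
  have h2 : Real.log (s / 64) ≤ s / 64 - 1 := Real.log_le_sub_one_of_pos (by linarith)
  have h3 := log_two_ge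
  unfold Real.logb
  rw [div_le_iff₀ (by linarith)]
  nlinarith

lemma sampleBound_pos {δ ρ : ℝ} (hδ : 0 < δ) (hδ' : δ ≤ 1 / 12) : 1 ≤ sampleBound δ ρ := by
  have ha : 0 ≤ (ρ ^ 2)⁻¹ := by positivity
  have := two_le_log_div hδ hδ' (one_le_log_exp_one_add ha)
  refine Nat.one_le_iff_ne_zero.2 (Nat.pos_iff_ne_zero.1 (Nat.ceil_pos.2 ?_))
  positivity

/-- With `t = (1 + a) s`, `a = ρ⁻²`, the iterated logarithm in `C_δ(t)` splits as
`log₂ (2t) ≤ (1 + log₂ (1 + a)) (1 + log₂ s)`; the second factor is absorbed by `s`. -/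
lemma confWidth_le_of_sampleBound_le {δ ρ : ℝ} (hδ : 0 < δ) (hδ' : δ ≤ 1 / 12) (hρ : 0 < ρ) {t : ℕ}
    (ht : sampleBound δ ρ ≤ t) : confWidth δ t ≤ ρ := by
  have ht' := (Nat.ceil_le.1 ht)
  set a : ℝ := (ρ ^ 2)⁻¹ with ha
  have ha0 : 0 < a := by positivity
  have hLe := one_le_log_exp_one_add ha0.le
  set Le := Real.log (Real.exp 1 + a) with hLedef
  have hH := two_le_log_div hδ hδ' hLe
  set H := Real.log (Le / δ) with hHdef
  set s : ℝ := t / (1 + a) with hs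
  have hst : (t : ℝ) = (1 + a) * s := by rw [hs]; field_simp
  have hsH : 32 * H ≤ s := by
    rw [hs, le_div_iff₀ (by positivity)]; linarith
  have hs64 : 64 ≤ s := by linarith
  have hl2 := log_two_ge
  have hsplit : Real.logb 2 (2 * t) ≤ (3 * Le) * (s / 4) := by
    have h1 : Real.logb 2 (2 * t) = 1 + Real.logb 2 (1 + a) + Real.logb 2 s := by
      rw [hst, Real.logb_mul (by norm_num) (by positivity),
        Real.logb_mul (by positivity) (by positivity), Real.logb_self_eq_one (by norm_num)]
      ring
    have h2 : 1 + Real.logb 2 (1 + a) ≤ 3 * Le := by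
      have : Real.log (1 + a) ≤ Le :=
        Real.log_le_log (by linarith) (by linarith [Real.add_one_le_exp (1 : ℝ)])
      have : Real.logb 2 (1 + a) ≤ 3 / 2 * Le := by
        unfold Real.logb
        rw [div_le_iff₀ (by linarith)]
        nlinarith
      linarith
    have h3 := logb_two_le hs64
    rw [h1]
    nlinarith
  have hpos : 1 ≤ Real.logb 2 (2 * t) := by
    have ht1 : (1 : ℝ) ≤ t := by rw [hst]; nlinarith
    rw [Real.le_logb_iff_rpow_le (by norm_num) (by linarith)]
    rw [Real.rpow_one]; linarith
  have hlog : Real.log (Real.logb 2 (2 * t) / δ) ≤ H + Real.log 3 + Real.log (s / 4) := by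
    have : Real.log (Real.logb 2 (2 * t) / δ) ≤ Real.log ((Le / δ) * 3 * (s / 4)) := by
      apply Real.log_le_log (by positivity)
      rw [div_le_iff₀ hδ]
      calc _ ≤ _ := hsplit
        _ = _ := by field_simp
    rwa [Real.log_mul (by positivity) (by positivity), Real.log_mul (by positivity) (by norm_num)]
      at this
  have hl3 : Real.log 3 ≤ 2 := by
    have := Real.log_le_sub_one_of_pos (show (0 : ℝ) < 3 by norm_num); linarith
  have hls : Real.log (s / 4) ≤ s / 8 := by
    have h := logb_two_le hs64
    have h1 : Real.log s ≤ s / 8 := by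
      refine le_trans ?_ h
      unfold Real.logb
      rw [le_div_iff₀ (by linarith)]
      nlinarith [Real.log_nonneg (show (1 : ℝ) ≤ s by linarith), Real.log_two_lt_d9]
    exact (Real.log_le_log (by linarith) (by linarith)).trans h1
  unfold confWidth
  rw [Real.sqrt_le_left hρ.le, div_le_iff₀ (by rw [hst]; positivity), hst]
  have hρa : ρ ^ 2 * a = 1 := by rw [ha]; field_simp
  have : s ≤ ρ ^ 2 * ((1 + a) * s) := by
    have : ρ ^ 2 * ((1 + a) * s) = ρ ^ 2 * s + s := by linear_combination s * hρa
    rw [this]; nlinarith [sq_nonneg ρ]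
  rw [← hst] at this ⊢
  linarith

lemma log_exp_one_add_le {a R : ℝ} (ha : 0 ≤ a) (haR : a ≤ 400 * R) :
    Real.log (Real.exp 1 + a) ≤ 400 * Real.log (Real.exp 1 + R) := by
  have hR : 0 ≤ R := by linarith
  have h1 := one_le_log_exp_one_add hR
  have he := Real.exp_pos 1
  have : Real.log (Real.exp 1 + a) ≤ Real.log (400 * (Real.exp 1 + R)) :=
    Real.log_le_log (by positivity) (by linarith)
  rw [Real.log_mul (by norm_num) (by positivity)] at this
  have h4 : Real.log 400 ≤ 399 := by
    have := Real.log_le_sub_one_of_pos (show (0 : ℝ) < 400 by norm_num); linarith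
  nlinarith

/-- For a gap `g` with `g⁻² ≤ R` and a failure probability that is polynomial in `δ / n`, the
number of samples needed to reach the width `g / 20` is at most `(1 + g⁻²) log (n/δ log (e + R))`
up to a constant. -/
lemma sampleBound_le {n : ℕ} {δ δ' g R : ℝ} (hn : 2 ≤ n) (hδ : 0 < δ) (hδ2 : δ < 1 / 2)
    (hδ' : δ / ((n + 1) * n) ≤ δ') (hδ'12 : δ' ≤ 1 / 12) (hg : 0 < g) (hgR : (g ^ 2)⁻¹ ≤ R) :
    (sampleBound δ' (g / 20) : ℝ) ≤
      130000 * (1 + (g ^ 2)⁻¹) * Real.log (n / δ * Real.log (Real.exp 1 + R)) := by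
  have hn' : (2 : ℝ) ≤ n := by exact_mod_cast hn
  set a : ℝ := ((g / 20) ^ 2)⁻¹ with ha
  have hag : a = 400 * (g ^ 2)⁻¹ := by rw [ha, div_pow, inv_div]; ring
  have hg2 : 0 < (g ^ 2)⁻¹ := by positivity
  have hR0 : 0 < R := by linarith
  have hδ'0 : 0 < δ' := lt_of_lt_of_le (by positivity) hδ'
  have hLe := one_le_log_exp_one_add (show 0 ≤ a by rw [hag]; positivity)
  have hH := two_le_log_div hδ'0 hδ'12 hLe
  have hLR := one_le_log_exp_one_add hR0.le
  have hle : Real.log (Real.exp 1 + a) ≤ 400 * Real.log (Real.exp 1 + R) :=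
    log_exp_one_add_le (by rw [hag]; positivity) (by rw [hag]; linarith)
  set LR := Real.log (Real.exp 1 + R)
  set H := Real.log (Real.log (Real.exp 1 + a) / δ') with hHdef
  set x : ℝ := n / δ * LR with hx
  have hnδ : 4 ≤ n / δ := by rw [le_div_iff₀ hδ]; linarith
  have hx4 : 4 ≤ x := by rw [hx]; nlinarith
  have hHx : H ≤ 8 * Real.log x := by
    have h1 : Real.log (Real.exp 1 + a) / δ' ≤ 512 * x ^ 3 := by
      have h2 : Real.log (Real.exp 1 + a) / δ' ≤ (400 * LR) / (δ / ((n + 1) * n)) := by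
        gcongr
      refine h2.trans ?_
      have h3 : (400 * LR) / (δ / ((n + 1) * n)) = 400 * (n / δ * LR) * (n + 1) := by
        field_simp
      rw [h3, ← hx]
      have hnx : (n : ℝ) ≤ x := by
        have : (n : ℝ) ≤ n / δ := by rw [le_div_iff₀ hδ]; nlinarith
        rw [hx]; nlinarith
      have : (n : ℝ) + 1 ≤ x ^ 2 := by nlinarith
      calc 400 * x * (n + 1) ≤ 400 * x * x ^ 2 := by gcongr
        _ ≤ 512 * x ^ 3 := by ring_nf; nlinarith [pow_pos (show 0 < x by linarith) 3]
    have h5 : H ≤ Real.log (512 * x ^ 3) := Real.log_le_log (by positivity) h1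
    have h6 : 512 * x ^ 3 ≤ x ^ 8 := by
      have : (512 : ℝ) ≤ x ^ 5 := by
        calc (512 : ℝ) ≤ 4 ^ 5 := by norm_num
          _ ≤ x ^ 5 := by gcongr
      calc 512 * x ^ 3 ≤ x ^ 5 * x ^ 3 := by gcongr
        _ = x ^ 8 := by ring
    have h7 := Real.log_le_log (by positivity) h6
    rw [Real.log_pow] at h7
    push_cast at h7
    linarith
  have hceil : (sampleBound δ' (g / 20) : ℝ) ≤ 32 * (1 + a) * H + 1 := by
    refine (Nat.ceil_lt_add_one ?_).le
    positivity
  have hA : 1 + a ≤ 400 * (1 + (g ^ 2)⁻¹) := by rw [hag]; linarith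
  have hlx : 0 < Real.log x := Real.log_pos (by linarith)
  have hmul : (1 + a) * H ≤ (400 * (1 + (g ^ 2)⁻¹)) * (8 * Real.log x) := by
    gcongr
  have h1 : 1 ≤ (1 + a) * H := by nlinarith
  nlinarith

/-! ### A finite-sample law of the iterated logarithm -/

/-- The past of the first `n` terms of a real sequence of random variables. -/
def pastFiltration {Ω : Type v} {mΩ : MeasurableSpace Ω} (Z : ℕ → Ω → ℝ)
    (hZ : ∀ s, Measurable (Z s)) : Filtration ℕ mΩ where
  seq n := ⨆ s ∈ Set.Iio n, MeasurableSpace.comap (Z s) inferInstance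
  mono' _ _ h := biSup_mono fun _ hs => lt_of_lt_of_le hs h
  le' _ := iSup₂_le fun _ _ => (hZ _).comap_le

lemma measurable_pastFiltration {Ω : Type v} {mΩ : MeasurableSpace Ω} (Z : ℕ → Ω → ℝ)
    (hZ : ∀ s, Measurable (Z s)) {s n : ℕ} (h : s < n) :
    Measurable[pastFiltration Z hZ n] (Z s) := by
  rw [measurable_iff_comap_le]
  exact le_iSup₂_of_le (f := fun s (_ : s ∈ Set.Iio n) =>
    MeasurableSpace.comap (Z s) inferInstance) s h le_rfl

lemma prod_measurable_past {Ω : Type v} {mΩ : MeasurableSpace Ω} (Z : ℕ → Ω → ℝ)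
    (hZ : ∀ s, Measurable (Z s)) (n : ℕ) :
    Measurable[pastFiltration Z hZ n] (fun ω => ∏ s ∈ Finset.range n, Z s ω) :=
  Finset.measurable_fun_prod _ fun _ hs => measurable_pastFiltration Z hZ (Finset.mem_range.1 hs)

lemma indepFun_past {Ω : Type v} {mΩ : MeasurableSpace Ω} {μ : Measure Ω} (Z : ℕ → Ω → ℝ)
    (hZ : ∀ s, Measurable (Z s)) (hind : iIndepFun Z μ) (n : ℕ) {f : Ω → ℝ}
    (hf : Measurable[pastFiltration Z hZ n] f) : IndepFun f (Z n) μ := by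
  have h := indep_iSup_of_disjoint (m := fun s => MeasurableSpace.comap (Z s) inferInstance)
    (fun s => (hZ s).comap_le) hind (S := Set.Iio n) (T := {n}) (by simp)
  rw [IndepFun_iff_Indep]
  refine indep_of_indep_of_le_left (indep_of_indep_of_le_right h ?_) hf.comap_le
  simp

lemma integrable_prod_range {Ω : Type v} {mΩ : MeasurableSpace Ω} {μ : Measure Ω}
    [IsProbabilityMeasure μ] (Z : ℕ → Ω → ℝ)
    (hZ : ∀ s, Measurable (Z s)) (hind : iIndepFun Z μ) (hint : ∀ s, Integrable (Z s) μ) (n : ℕ) :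
    Integrable (fun ω => ∏ s ∈ Finset.range n, Z s ω) μ := by
  induction n with
  | zero => simp
  | succ n ih =>
    simp_rw [Finset.prod_range_succ]
    exact (indepFun_past Z hZ hind n (prod_measurable_past Z hZ n)).integrable_mul ih (hint n)

lemma submartingale_prod {Ω : Type v} {mΩ : MeasurableSpace Ω} {μ : Measure Ω}
    [IsProbabilityMeasure μ] (Z : ℕ → Ω → ℝ)
    (hZ : ∀ s, Measurable (Z s)) (hind : iIndepFun Z μ) (hint : ∀ s, Integrable (Z s) μ)
    (hmean : ∀ s, ∫ ω, Z s ω ∂μ = 1) :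
    Submartingale (fun n ω => ∏ s ∈ Finset.range n, Z s ω) (pastFiltration Z hZ) μ := by
  have hI := integrable_prod_range Z hZ hind hint
  refine submartingale_of_setIntegral_le_succ
    (fun n => (prod_measurable_past Z hZ n).stronglyMeasurable) hI fun n A hA => le_of_eq ?_
  have hA' : MeasurableSet A := (pastFiltration Z hZ).le n A hA
  rw [← integral_indicator hA', ← integral_indicator hA']
  have hm : Measurable[pastFiltration Z hZ n]
      (A.indicator fun ω => ∏ s ∈ Finset.range n, Z s ω) :=
    (prod_measurable_past Z hZ n).indicator hA
  have hi := indepFun_past Z hZ hind n hm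
  have h := hi.integral_fun_mul_eq_mul_integral
    (hm.mono ((pastFiltration Z hZ).le n) le_rfl).aestronglyMeasurable
    (hZ n).aestronglyMeasurable
  rw [hmean, mul_one] at h
  rw [← h]
  congr 1
  ext ω
  by_cases hω : ω ∈ A <;> simp [hω, Finset.prod_range_succ]

/-- Ville's inequality for a product of independent nonnegative variables with mean `1`. -/
lemma measure_exists_prod_ge {Ω : Type v} {mΩ : MeasurableSpace Ω} {μ : Measure Ω}
    [IsProbabilityMeasure μ] (Z : ℕ → Ω → ℝ)
    (hZ : ∀ s, Measurable (Z s)) (hind : iIndepFun Z μ) (hint : ∀ s, Integrable (Z s) μ)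
    (hmean : ∀ s, ∫ ω, Z s ω ∂μ = 1) (h0 : ∀ s ω, 0 ≤ Z s ω) {a : ℝ} (ha : 0 < a) (N : ℕ) :
    μ {ω | ∃ n ≤ N, a ≤ ∏ s ∈ Finset.range n, Z s ω} ≤ ENNReal.ofReal a⁻¹ := by
  have hsub := submartingale_prod Z hZ hind hint hmean
  have hmax := maximal_ineq hsub (fun n ω => Finset.prod_nonneg fun s _ => h0 s ω)
    (ε := a.toNNReal) N
  have hone : ∀ n, ∫ ω, ∏ s ∈ Finset.range n, Z s ω ∂μ = 1 := by
    intro n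
    have h := (hind.precomp (Fin.val_injective (n := n))).integral_fun_prod_eq_prod_integral
      fun i => (hZ i).aestronglyMeasurable
    simpa [Finset.prod_range, hmean] using h
  have hle : ENNReal.ofReal (∫ ω in {ω | (a.toNNReal : ℝ) ≤ (Finset.range (N + 1)).sup'
      Finset.nonempty_range_add_one fun k => ∏ s ∈ Finset.range k, Z s ω},
      ∏ s ∈ Finset.range N, Z s ω ∂μ) ≤ 1 := by
    rw [← ENNReal.ofReal_one, ← hone N]
    exact ENNReal.ofReal_le_ofReal (setIntegral_le_integral
      (integrable_prod_range Z hZ hind hint N)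
      (Filter.Eventually.of_forall fun ω => Finset.prod_nonneg fun s _ => h0 s ω))
  have hset : {ω | ∃ n ≤ N, a ≤ ∏ s ∈ Finset.range n, Z s ω} ⊆
      {ω | (a.toNNReal : ℝ) ≤ (Finset.range (N + 1)).sup'
      Finset.nonempty_range_add_one fun k => ∏ s ∈ Finset.range k, Z s ω} := by
    rintro ω ⟨n, hn, hω⟩
    simp only [Set.mem_ofPred_eq, Real.coe_toNNReal a ha.le, Finset.le_sup'_iff]
    exact ⟨n, by simpa using Nat.lt_succ_of_le hn, hω⟩
  refine (measure_mono hset).trans ?_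
  have := hmax.trans hle
  rw [ENNReal.ofReal_inv_of_pos ha, ENNReal.le_inv_iff_mul_le, mul_comm]
  simpa [ENNReal.smul_def, ENNReal.ofReal] using this

/-- A line-crossing inequality for sums of independent sub-Gaussian variables with scale `1`. -/
lemma measure_exists_line_ge {Ω : Type v} {mΩ : MeasurableSpace Ω} {μ : Measure Ω}
    [IsProbabilityMeasure μ] (ξ : ℕ → Ω → ℝ) (hξ : ∀ s, Measurable (ξ s)) (hind : iIndepFun ξ μ)
    (hsg : ∀ s, HasSubgaussianMGF (ξ s) 1 μ) (lam x : ℝ) (N : ℕ) :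
    μ {ω | ∃ n ≤ N, x ≤ lam * ∑ s ∈ Finset.range n, ξ s ω - lam ^ 2 * n / 2} ≤
      ENNReal.ofReal (Real.exp (-x)) := by
  set Z : ℕ → Ω → ℝ := fun s ω => Real.exp (lam * ξ s ω) / mgf (ξ s) μ lam with hZdef
  have hmpos : ∀ s, 0 < mgf (ξ s) μ lam := fun s => mgf_pos ((hsg s).integrable_exp_mul lam)
  have hZm : ∀ s, Measurable (Z s) := fun s => by
    have := hξ s
    fun_prop
  have hZi : iIndepFun Z μ :=
    hind.comp (fun s r => Real.exp (lam * r) / mgf (ξ s) μ lam) fun s => by fun_prop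
  have hint : ∀ s, Integrable (Z s) μ := fun s =>
    ((hsg s).integrable_exp_mul lam).div_const _
  have hmean : ∀ s, ∫ ω, Z s ω ∂μ = 1 := fun s => by
    simp only [hZdef, integral_div]
    exact div_self (hmpos s).ne'
  have h := measure_exists_prod_ge Z hZm hZi hint hmean
    (fun s ω => div_nonneg (Real.exp_pos _).le (hmpos s).le) (Real.exp_pos x) N
  rw [← Real.exp_neg] at h
  refine (measure_mono ?_).trans h
  rintro ω ⟨n, hn, hω⟩
  refine ⟨n, hn, (Real.exp_le_exp.2 hω).trans ?_⟩
  have hfac : ∀ s ∈ Finset.range n, Real.exp (lam * ξ s ω - lam ^ 2 / 2) ≤ Z s ω := fun s _ => by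
    rw [Real.exp_sub]
    simp only [hZdef]
    have := (hsg s).mgf_le lam
    simp only [NNReal.coe_one, one_mul] at this
    have := hmpos s
    gcongr
  calc _ = ∏ s ∈ Finset.range n, Real.exp (lam * ξ s ω - lam ^ 2 / 2) := by
        rw [← Real.exp_sum, Finset.sum_sub_distrib, Finset.mul_sum]
        simp
        ring
    _ ≤ _ := Finset.prod_le_prod (fun s _ => (Real.exp_pos _).le) hfac

/-- On the block `4 ^ b ≤ t ≤ 4 ^ (b + 1)` the boundary `t C_δ(t)` lies above a line of slope
`≈ √ℓ / 2 ^ b`; the optimal line through the two end points gives the exponent `16 / 9`. -/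
lemma measure_block {Ω : Type v} {mΩ : MeasurableSpace Ω} {μ : Measure Ω}
    [IsProbabilityMeasure μ] (ξ : ℕ → Ω → ℝ) (hξ : ∀ s, Measurable (ξ s)) (hind : iIndepFun ξ μ)
    (hsg : ∀ s, HasSubgaussianMGF (ξ s) 1 μ) {δ : ℝ} (hδ : 0 < δ) (hδ1 : δ ≤ 1) (b : ℕ) :
    μ {ω | ∃ t : ℕ, 4 ^ b ≤ t ∧ t ≤ 4 ^ (b + 1) ∧
        t * confWidth δ t ≤ ∑ s ∈ Finset.range t, ξ s ω} ≤
      ENNReal.ofReal (Real.exp (-(3 / 2 * Real.log ((2 * b + 1) / δ)))) := by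
  set ℓ := Real.log ((2 * b + 1) / δ) with hℓ
  have hℓ0 : 0 ≤ ℓ := Real.log_nonneg (by
    rw [le_div_iff₀ hδ]; have : (0 : ℝ) ≤ b := b.cast_nonneg
    linarith)
  have h := measure_exists_line_ge ξ hξ hind hsg (4 / 3 * √ℓ / 2 ^ b) (16 / 9 * ℓ) (4 ^ (b + 1))
  refine (measure_mono ?_).trans
    (h.trans (ENNReal.ofReal_le_ofReal (Real.exp_le_exp.2 (by linarith))))
  rintro ω ⟨t, ht1, ht2, hω⟩
  refine ⟨t, ht2, ?_⟩
  have ht1' : (4 : ℝ) ^ b ≤ t := by exact_mod_cast ht1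
  have ht2' : (t : ℝ) ≤ 4 ^ (b + 1) := by exact_mod_cast ht2
  have ht0 : (0 : ℝ) < t := lt_of_lt_of_le (by positivity) ht1'
  have h4 : (4 : ℝ) ^ b = (2 ^ b) ^ 2 := by rw [← pow_mul, mul_comm, pow_mul]; norm_num
  have hlogb : (2 * b + 1 : ℝ) ≤ Real.logb 2 (2 * t) := by
    rw [Real.le_logb_iff_rpow_le (by norm_num) (by positivity)]
    have : (2 : ℝ) ^ (2 * b + 1 : ℝ) = 2 * 4 ^ b := by
      have e : (2 * b + 1 : ℝ) = ((2 * b + 1 : ℕ) : ℝ) := by push_cast; ring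
      rw [e, Real.rpow_natCast, pow_succ, pow_mul]; norm_num; ring
    rw [this]; linarith
  have hlog : ℓ ≤ Real.log (Real.logb 2 (2 * t) / δ) :=
    Real.log_le_log (by positivity) (by gcongr)
  have hbd : 2 * √ℓ * √t ≤ t * confWidth δ t := by
    unfold confWidth
    have e1 : 2 * √ℓ * √t = √(4 * ℓ * t) := by
      rw [Real.sqrt_mul (by positivity), Real.sqrt_mul (by norm_num)]
      rw [show (4 : ℝ) = 2 ^ 2 by norm_num, Real.sqrt_sq (by norm_num)]
    have e2 : t * √(4 * Real.log (Real.logb 2 (2 * t) / δ) / t)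
        = √(4 * Real.log (Real.logb 2 (2 * t) / δ) * t) := by
      have : 4 * Real.log (Real.logb 2 (2 * t) / δ) * t
          = t ^ 2 * (4 * Real.log (Real.logb 2 (2 * t) / δ) / t) := by field_simp
      rw [this, Real.sqrt_mul (by positivity), Real.sqrt_sq ht0.le]
    rw [e1, e2]
    apply Real.sqrt_le_sqrt
    gcongr
  set v := √(t : ℝ) / 2 ^ b with hv
  have hsq : √(t : ℝ) ^ 2 = t := Real.sq_sqrt ht0.le
  have hv1 : 1 ≤ v := by
    rw [hv, le_div_iff₀ (by positivity), one_mul]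
    exact Real.le_sqrt_of_sq_le (by rw [← h4]; exact ht1')
  have hv2 : v ≤ 2 := by
    rw [hv, div_le_iff₀ (by positivity)]
    refine Real.sqrt_le_iff.2 ⟨by positivity, ?_⟩
    rw [mul_pow, ← h4]; rw [pow_succ] at ht2'; linarith
  have hsℓ : √ℓ ^ 2 = ℓ := Real.sq_sqrt hℓ0
  have hlam0 : 0 ≤ 4 / 3 * √ℓ / 2 ^ b := by positivity
  have e3 : 4 / 3 * √ℓ / 2 ^ b * (2 * √ℓ * √t) = 8 / 3 * ℓ * v := by
    rw [← hsℓ, hv, hsℓ]; field_simp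
    linear_combination 8 * hsℓ
  have e4 : (4 / 3 * √ℓ / 2 ^ b) ^ 2 * t / 2 = 8 / 9 * ℓ * v ^ 2 := by
    rw [hv, div_pow, mul_pow, hsℓ, div_pow (√(t : ℝ)), hsq]; ring
  have h5 := mul_le_mul_of_nonneg_left (hbd.trans hω) hlam0
  rw [e3] at h5
  rw [e4]
  nlinarith [mul_nonneg hℓ0 (mul_nonneg (sub_nonneg.2 hv1) (sub_nonneg.2 hv2))]

lemma exp_neg_three_halves_log {x : ℝ} (hx : 0 < x) :
    Real.exp (-(3 / 2 * Real.log x)) = (x * √x)⁻¹ := by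
  rw [Real.exp_neg, Real.sqrt_eq_rpow, Real.rpow_def_of_pos hx]
  nth_rw 2 [← Real.exp_log hx]
  rw [← Real.exp_add]
  congr 2; ring

/-- `∑_{b < N} (2b+1)^(-3/2) ≤ 1 + 1/√2`, by comparison with the telescoping series of
`1/√(2b) - 1/√(2b+2)`. -/
lemma sum_three_halves_le (N : ℕ) :
    ∑ b ∈ Finset.range (N + 1), ((2 * b + 1 : ℝ) * √(2 * b + 1))⁻¹ ≤
      1 + (√2)⁻¹ - (√(2 * N + 2))⁻¹ := by
  induction N with
  | zero => simp
  | succ N ih =>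
    rw [Finset.sum_range_succ]
    push_cast
    have hN : (0 : ℝ) ≤ N := N.cast_nonneg
    set a : ℝ := 2 * (N + 1) + 1 with ha
    have e1 : (2 * N + 2 : ℝ) = a - 1 := by rw [ha]; ring
    have e2 : (2 * ((N : ℝ) + 1) + 2 : ℝ) = a + 1 := by rw [ha]; ring
    have ha3 : 3 ≤ a := by rw [ha]; linarith
    rw [e1] at ih
    rw [e2]
    set p := √(a - 1) with hp
    set r := √(a + 1) with hr
    have hp2 : p ^ 2 = a - 1 := Real.sq_sqrt (by linarith)
    have hr2 : r ^ 2 = a + 1 := Real.sq_sqrt (by linarith)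
    have hs2 : √a ^ 2 = a := Real.sq_sqrt (by linarith)
    have hp0 : 0 < p := Real.sqrt_pos.2 (by linarith)
    have hr0 : 0 < r := Real.sqrt_pos.2 (by linarith)
    have hs0 : 0 < √a := Real.sqrt_pos.2 (by linarith)
    have hpr : p * r ≤ a := by nlinarith [sq_nonneg (p - r)]
    have hsum : p + r ≤ 2 * √a := by
      refine abs_le_of_sq_le_sq' ?_ (by positivity) |>.2
      nlinarith
    have hdiff : (r - p) * (p + r) = 2 := by ring_nf; rw [hp2, hr2]; ring
    have hkey : (a * √a)⁻¹ ≤ p⁻¹ - r⁻¹ := by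
      have : p⁻¹ - r⁻¹ = 2 / (p * r * (p + r)) := by
        rw [← hdiff]; field_simp
      rw [this, inv_eq_one_div, div_le_div_iff₀ (by positivity) (by positivity)]
      have : p * r * (p + r) ≤ a * (2 * √a) := by gcongr
      linarith
    linarith

lemma sum_block_le {δ : ℝ} (hδ : 0 < δ) (hδ' : δ ≤ 1 / 12) (N : ℕ) :
    ∑ b ∈ Finset.range N, Real.exp (-(3 / 2 * Real.log ((2 * b + 1) / δ))) ≤ δ / 2 := by
  have h1 : ∀ b : ℕ, Real.exp (-(3 / 2 * Real.log ((2 * b + 1) / δ)))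
      = δ * √δ * ((2 * b + 1 : ℝ) * √(2 * b + 1))⁻¹ := fun b => by
    rw [exp_neg_three_halves_log (by positivity), Real.sqrt_div (by positivity)]
    have : 0 < √δ := Real.sqrt_pos.2 hδ
    have : (0 : ℝ) < √(2 * b + 1) := Real.sqrt_pos.2 (by positivity)
    field_simp
  simp_rw [h1, ← Finset.mul_sum]
  have h2 : ∑ b ∈ Finset.range N, ((2 * b + 1 : ℝ) * √(2 * b + 1))⁻¹ ≤ 1 + (√2)⁻¹ := by
    rcases N with _ | N
    · simp; positivity
    · have := sum_three_halves_le N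
      have : 0 ≤ (√(2 * N + 2 : ℝ))⁻¹ := by positivity
      linarith
  have h3 : (√2)⁻¹ ≤ (0.7072 : ℝ) := by
    rw [inv_le_comm₀ (by positivity) (by norm_num)]
    exact Real.le_sqrt_of_sq_le (by norm_num)
  have h4 : √δ ≤ 0.2887 := Real.sqrt_le_iff.2 ⟨by norm_num, by norm_num at hδ' ⊢; linarith⟩
  have h5 : 0 ≤ √δ := Real.sqrt_nonneg _
  calc _ ≤ δ * √δ * (1 + (√2)⁻¹) := by gcongr
    _ ≤ δ * 0.2887 * (1 + 0.7072) := by gcongr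
    _ ≤ δ / 2 := by nlinarith

lemma measure_exists_ge_confWidth {Ω : Type v} {mΩ : MeasurableSpace Ω} {μ : Measure Ω}
    [IsProbabilityMeasure μ] (ξ : ℕ → Ω → ℝ) (hξ : ∀ s, Measurable (ξ s)) (hind : iIndepFun ξ μ)
    (hsg : ∀ s, HasSubgaussianMGF (ξ s) 1 μ) {δ : ℝ} (hδ : 0 < δ) (hδ' : δ ≤ 1 / 12) :
    μ {ω | ∃ t : ℕ, 1 ≤ t ∧ t * confWidth δ t ≤ ∑ s ∈ Finset.range t, ξ s ω} ≤
      ENNReal.ofReal (δ / 2) := by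
  have hcov : {ω | ∃ t : ℕ, 1 ≤ t ∧ t * confWidth δ t ≤ ∑ s ∈ Finset.range t, ξ s ω} ⊆
      ⋃ b : ℕ, {ω | ∃ t : ℕ, 4 ^ b ≤ t ∧ t ≤ 4 ^ (b + 1) ∧
        t * confWidth δ t ≤ ∑ s ∈ Finset.range t, ξ s ω} := by
    rintro ω ⟨t, ht, hω⟩
    refine Set.mem_iUnion.2 ⟨Nat.log 4 t, t, Nat.pow_log_le_self 4 (by omega),
      (Nat.lt_pow_succ_log_self (by norm_num) t).le, hω⟩
  refine (measure_mono hcov).trans ((measure_iUnion_le _).trans ?_)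
  refine (ENNReal.tsum_le_tsum fun b => measure_block ξ hξ hind hsg hδ (by linarith) b).trans ?_
  refine ENNReal.tsum_le_of_sum_range_le fun N => ?_
  rw [← ENNReal.ofReal_sum_of_nonneg fun _ _ => (Real.exp_pos _).le]
  exact ENNReal.ofReal_le_ofReal (sum_block_le hδ hδ' N)

/-- With probability at least `1 - δ` the running averages of independent centred variables,
sub-Gaussian with scale `1`, stay within the width `C_δ`. -/
lemma measure_exists_abs_gt_confWidth {Ω : Type v} {mΩ : MeasurableSpace Ω} {μ : Measure Ω}
    [IsProbabilityMeasure μ] (η : ℕ → Ω → ℝ) (d : ℝ) (hη : ∀ s, Measurable (η s))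
    (hind : iIndepFun η μ) (hsg : ∀ s, HasSubgaussianMGF (fun ω => η s ω - d) 1 μ)
    {δ : ℝ} (hδ : 0 < δ) (hδ' : δ ≤ 1 / 12) :
    μ {ω | ∃ t : ℕ, 1 ≤ t ∧ confWidth δ t < |(∑ s ∈ Finset.range t, η s ω) / t - d|} ≤
      ENNReal.ofReal δ := by
  have h1 := measure_exists_ge_confWidth (fun s ω => η s ω - d) (fun s => (hη s).sub_const d)
    (hind.comp (fun _ r => r - d) fun _ => by fun_prop) hsg hδ hδ'
  have h2 := measure_exists_ge_confWidth (fun s ω => -(η s ω - d))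
    (fun s => ((hη s).sub_const d).neg)
    (hind.comp (fun _ r => -(r - d)) fun _ => by fun_prop) (fun s => (hsg s).neg) hδ hδ'
  have hsub : {ω | ∃ t : ℕ, 1 ≤ t ∧ confWidth δ t < |(∑ s ∈ Finset.range t, η s ω) / t - d|} ⊆
      {ω | ∃ t : ℕ, 1 ≤ t ∧ t * confWidth δ t ≤ ∑ s ∈ Finset.range t, (η s ω - d)} ∪
      {ω | ∃ t : ℕ, 1 ≤ t ∧ t * confWidth δ t ≤ ∑ s ∈ Finset.range t, -(η s ω - d)} := by
    rintro ω ⟨t, ht, hω⟩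
    have ht0 : (0 : ℝ) < t := by exact_mod_cast ht
    have e : (∑ s ∈ Finset.range t, (η s ω - d)) =
        t * ((∑ s ∈ Finset.range t, η s ω) / t - d) := by
      rw [Finset.sum_sub_distrib]
      simp
      field_simp
    rcases lt_abs.1 hω with h | h
    · refine Or.inl ⟨t, ht, ?_⟩
      rw [e]; gcongr
    · refine Or.inr ⟨t, ht, ?_⟩
      rw [Finset.sum_neg_distrib, e, ← mul_neg]; gcongr
  refine (measure_mono hsub).trans ((measure_union_le _ _).trans ((add_le_add h1 h2).trans ?_))
  rw [← ENNReal.ofReal_add (by linarith) (by linarith)]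
  exact le_of_eq (by ring_nf)

/-! ### Packing and growth in terms of the expansion constant -/

section Expansion

variable {M : Type u} [MetricSpace M] {S : Set M}

lemma expansionConst_set_nonempty (hS : S.Finite) :
    {c : ℝ | 2 ≤ c ∧ ∀ x ∈ S, ∀ r : ℝ, 0 < r → ((S ∩ Metric.closedBall x (2 * r)).ncard : ℝ) ≤
      c * ((S ∩ Metric.closedBall x r).ncard : ℝ)}.Nonempty := by
  refine ⟨max 2 S.ncard, le_max_left _ _, fun x hx r hr => ?_⟩
  have h1 : ((S ∩ Metric.closedBall x (2 * r)).ncard : ℝ) ≤ S.ncard := by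
    exact_mod_cast Set.ncard_le_ncard Set.inter_subset_left hS
  have h2 : (1 : ℝ) ≤ (S ∩ Metric.closedBall x r).ncard := by
    have : 0 < (S ∩ Metric.closedBall x r).ncard :=
      (Set.ncard_pos (hS.inter_of_left _)).2 ⟨x, hx, Metric.mem_closedBall_self hr.le⟩
    exact_mod_cast this
  have h3 := le_max_right (2 : ℝ) S.ncard
  have h4 := le_max_left (2 : ℝ) S.ncard
  nlinarith

lemma two_le_expansionConst (hS : S.Finite) : 2 ≤ expansionConst S :=
  le_csInf (expansionConst_set_nonempty hS) fun _ h => h.1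

lemma ncard_closedBall_two_mul_le (hS : S.Finite) {x : M} (hx : x ∈ S) {r : ℝ} (hr : 0 < r) :
    ((S ∩ Metric.closedBall x (2 * r)).ncard : ℝ) ≤
      expansionConst S * ((S ∩ Metric.closedBall x r).ncard : ℝ) := by
  have h2 : 0 < ((S ∩ Metric.closedBall x r).ncard : ℝ) := by
    have : 0 < (S ∩ Metric.closedBall x r).ncard :=
      (Set.ncard_pos (hS.inter_of_left _)).2 ⟨x, hx, Metric.mem_closedBall_self hr.le⟩
    exact_mod_cast this
  rw [← div_le_iff₀ h2]
  refine le_csInf (expansionConst_set_nonempty hS) fun c hc => ?_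
  rw [div_le_iff₀ h2]
  exact hc.2 x hx r hr

lemma ncard_closedBall_two_pow_mul_le (hS : S.Finite) {x : M} (hx : x ∈ S) {r : ℝ} (hr : 0 < r)
    (k : ℕ) :
    ((S ∩ Metric.closedBall x (2 ^ k * r)).ncard : ℝ) ≤
      expansionConst S ^ k * ((S ∩ Metric.closedBall x r).ncard : ℝ) := by
  have hc := two_le_expansionConst hS
  induction k with
  | zero => simp
  | succ k ih =>
    have h := ncard_closedBall_two_mul_le hS hx (show 0 < 2 ^ k * r by positivity)
    rw [show (2 : ℝ) ^ (k + 1) * r = 2 * (2 ^ k * r) by ring, pow_succ']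
    refine h.trans ?_
    rw [mul_assoc]
    gcongr

lemma ncard_inter_closedBall_mono (hS : S.Finite) {x y : M} {r s : ℝ}
    (h : r + dist x y ≤ s) :
    ((S ∩ Metric.closedBall x r).ncard : ℝ) ≤ (S ∩ Metric.closedBall y s).ncard := by
  exact_mod_cast Set.ncard_le_ncard
    (Set.inter_subset_inter_right _ (Metric.closedBall_subset_closedBall' h))
    (hS.inter_of_left _)

/-- A `2r`-separated subset of a ball of radius `ρ` has at most `c ^ k` points if
`2 ρ + r ≤ 2 ^ k r`: the balls of radius `r` about its points are disjoint, and each of them holds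
at least a fraction `c⁻ᵏ` of the points of the ball of radius `ρ + r`. -/
lemma card_le_of_separated (hS : S.Finite) {P : Finset M} (hP : (P : Set M) ⊆ S) {z : M}
    {ρ r : ℝ} (hr : 0 < r) (k : ℕ) (hk : 2 * ρ + r ≤ 2 ^ k * r)
    (hsep : ∀ p ∈ P, ∀ p' ∈ P, p ≠ p' → 2 * r < dist p p') (hball : ∀ p ∈ P, dist z p ≤ ρ) :
    (P.card : ℝ) ≤ expansionConst S ^ k := by
  classical
  have hc := two_le_expansionConst hS
  rcases P.eq_empty_or_nonempty with rfl | ⟨p₀, hp₀⟩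
  · simp; positivity
  set W := S ∩ Metric.closedBall z (ρ + r) with hW
  have hWf : W.Finite := hS.inter_of_left _
  have hWpos : (0 : ℝ) < W.ncard := by
    have : 0 < W.ncard := (Set.ncard_pos hWf).2 ⟨p₀, hP hp₀, by
      rw [Metric.mem_closedBall, dist_comm]; linarith [hball p₀ hp₀]⟩
    exact_mod_cast this
  have hfin : ∀ p, (S ∩ Metric.closedBall p r).Finite := fun p => hS.inter_of_left _
  have hsum : ∑ p ∈ P, ((S ∩ Metric.closedBall p r).ncard : ℝ) ≤ W.ncard := by
    have hdisj : Set.PairwiseDisjoint (P : Set M) (fun p => (hfin p).toFinset) := by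
      intro p hp p' hp' hne
      rw [Function.onFun, Finset.disjoint_left]
      intro a ha ha'
      rw [Set.Finite.mem_toFinset] at ha ha'
      have h1 := Metric.mem_closedBall.1 ha.2
      have h2 := Metric.mem_closedBall.1 ha'.2
      have h3 := hsep p hp p' hp' hne
      have h4 := dist_triangle_left p p' a
      linarith
    have hsub : P.biUnion (fun p => (hfin p).toFinset) ⊆ hWf.toFinset := by
      intro a ha
      obtain ⟨p, hp, hap⟩ := Finset.mem_biUnion.1 ha
      rw [Set.Finite.mem_toFinset] at hap ⊢
      refine ⟨hap.1, ?_⟩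
      have h1 := Metric.mem_closedBall.1 hap.2
      have h2 := hball p hp
      have h3 := dist_triangle a p z
      rw [Metric.mem_closedBall]
      rw [dist_comm z p] at h2
      linarith
    have h := Finset.card_le_card hsub
    rw [Finset.card_biUnion hdisj] at h
    simp_rw [← Set.ncard_eq_toFinset_card _ (hfin _)] at h
    rw [← Set.ncard_eq_toFinset_card _ hWf] at h
    exact_mod_cast h
  have heach : ∀ p ∈ P, (W.ncard : ℝ) ≤
      expansionConst S ^ k * (S ∩ Metric.closedBall p r).ncard := fun p hp =>
    (ncard_inter_closedBall_mono hS (by linarith [hball p hp])).trans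
      (ncard_closedBall_two_pow_mul_le hS (hP hp) hr k)
  have h1 : (P.card : ℝ) * W.ncard ≤ expansionConst S ^ k * W.ncard := by
    calc (P.card : ℝ) * W.ncard = ∑ p ∈ P, (W.ncard : ℝ) := by simp
      _ ≤ ∑ p ∈ P, expansionConst S ^ k * ((S ∩ Metric.closedBall p r).ncard : ℝ) :=
        Finset.sum_le_sum heach
      _ = expansionConst S ^ k * ∑ p ∈ P, ((S ∩ Metric.closedBall p r).ncard : ℝ) := by
        rw [Finset.mul_sum]
      _ ≤ _ := by gcongr
  exact le_of_mul_le_mul_right h1 hWpos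

/-- A point at distance `ρ` from `q` forces the balls about `q` to grow between the radii
`ρ / 3` and `4 ρ / 3`. -/
lemma ncard_closedBall_growth (hS : S.Finite) {q z : M} (hz : z ∈ S) (hρ : 0 < dist q z) :
    (1 + (expansionConst S ^ 2)⁻¹) * (S ∩ Metric.closedBall q (dist q z / 3)).ncard ≤
      (S ∩ Metric.closedBall q (4 * dist q z / 3)).ncard := by
  have hc := two_le_expansionConst hS
  set ρ := dist q z with hρdef
  have hdisj : Disjoint (S ∩ Metric.closedBall q (ρ / 3)) (S ∩ Metric.closedBall z (ρ / 3)) := by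
    rw [Set.disjoint_left]
    rintro a ⟨-, ha⟩ ⟨-, ha'⟩
    rw [Metric.mem_closedBall] at ha ha'
    have := dist_triangle_left q z a
    linarith
  have h1 : ((S ∩ Metric.closedBall q (ρ / 3)).ncard : ℝ) + (S ∩ Metric.closedBall z (ρ / 3)).ncard
      ≤ (S ∩ Metric.closedBall q (4 * ρ / 3)).ncard := by
    rw [← Nat.cast_add, ← Set.ncard_union_eq hdisj (hS.inter_of_left _) (hS.inter_of_left _)]
    refine Nat.cast_le.2 (Set.ncard_le_ncard (Set.union_subset ?_ ?_) (hS.inter_of_left _))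
    · exact Set.inter_subset_inter_right _ (Metric.closedBall_subset_closedBall (by linarith))
    · refine Set.inter_subset_inter_right _ (Metric.closedBall_subset_closedBall' ?_)
      rw [dist_comm]; linarith
  have h2 : ((S ∩ Metric.closedBall q (ρ / 3)).ncard : ℝ) ≤
      expansionConst S ^ 2 * (S ∩ Metric.closedBall z (ρ / 3)).ncard := by
    refine (ncard_inter_closedBall_mono hS (y := z) ?_).trans
      (ncard_closedBall_two_pow_mul_le hS hz (show 0 < ρ / 3 by linarith) 2)
    linarith
  have h3 : (expansionConst S ^ 2)⁻¹ * (S ∩ Metric.closedBall q (ρ / 3)).ncard ≤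
      (S ∩ Metric.closedBall z (ρ / 3)).ncard := by
    rw [inv_mul_le_iff₀ (by positivity)]
    exact h2
  linarith

/-- If `q` is isolated in `S` up to the distance `r`, there are few points within `7 r / 2`. -/
lemma ncard_closedBall_le_of_isolated (hS : S.Finite) {q : M} (hq : q ∈ S) {r : ℝ} (hr : 0 < r)
    (hiso : ∀ x ∈ S, x ≠ q → r ≤ dist q x) :
    ((S ∩ Metric.closedBall q (7 / 2 * r)).ncard : ℝ) ≤ expansionConst S ^ 2 := by
  have h := ncard_closedBall_two_pow_mul_le hS hq (show 0 < 7 / 8 * r by linarith) 2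
  have hone : S ∩ Metric.closedBall q (7 / 8 * r) ⊆ {q} := by
    rintro x ⟨hx, hxb⟩
    by_contra hne
    have := hiso x hx hne
    rw [Metric.mem_closedBall, dist_comm] at hxb
    linarith
  have h1 : ((S ∩ Metric.closedBall q (7 / 8 * r)).ncard : ℝ) ≤ 1 := by
    have := Set.ncard_le_ncard hone
    rw [Set.ncard_singleton] at this
    exact_mod_cast this
  have hc := two_le_expansionConst hS
  rw [show (2 : ℝ) ^ 2 * (7 / 8 * r) = 7 / 2 * r by ring] at h
  nlinarith [sq_nonneg (expansionConst S)]

end Expansion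

/-! ### Loops, minima and queries -/

/-- A loop terminates when a bounded potential increases in each round. -/
lemma whileLoop_spec {σ : Type u} {done : σ → Prop} {step : σ → σ} {s : σ} (I : σ → Prop)
    (Φ : σ → ℕ) (B : ℕ) (h0 : I s)
    (hstep : ∀ a, I a → ¬ done a → I (step a) ∧ Φ a + 1 ≤ Φ (step a))
    (hB : ∀ a, I a → Φ a ≤ B) :
    ∃ s', whileLoop done step s = some s' ∧ I s' ∧ done s' := by
  classical
  have hex : ∃ t : ℕ, done (step^[t] s) := by
    by_contra! hno
    have : ∀ t : ℕ, I (step^[t] s) ∧ t ≤ Φ (step^[t] s) := by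
      intro t
      induction t with
      | zero => exact ⟨h0, Nat.zero_le _⟩
      | succ t ih =>
        rw [Function.iterate_succ_apply']
        obtain ⟨h1, h2⟩ := hstep _ ih.1 (hno t)
        exact ⟨h1, by omega⟩
    have h := this (B + 1)
    have := hB _ h.1
    omega
  refine ⟨step^[Nat.find hex] s, ?_, ?_, Nat.find_spec hex⟩
  · unfold whileLoop
    rw [dif_pos hex]
  · have : ∀ t : ℕ, t ≤ Nat.find hex → I (step^[t] s) := by
      intro t
      induction t with
      | zero => exact fun _ => h0
      | succ t ih =>
        intro ht
        rw [Function.iterate_succ_apply']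
        exact (hstep _ (ih (by omega)) (Nat.find_min hex (by omega))).1
    exact this _ le_rfl

section MinOver

variable {M : Type u} {S : Finset M} {f : M → ℝ}

lemma minOver_le {k : M} (hk : k ∈ S) : minOver S f ≤ f k :=
  csInf_le (S.finite_toSet.image f).bddBelow ⟨k, hk, rfl⟩

lemma exists_minOver_eq (hS : S.Nonempty) : ∃ k ∈ S, minOver S f = f k := by
  have h := Set.Nonempty.csInf_mem (s := f '' (S : Set M)) (hS.to_set.image f)
    (S.finite_toSet.image f)
  obtain ⟨k, hk, he⟩ := h
  exact ⟨k, hk, he.symm⟩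

lemma mem_argminSet {j : M} : j ∈ argminSet S f ↔ j ∈ S ∧ ∀ k ∈ S, f j ≤ f k := by
  simp [argminSet]

lemma argminSet_nonempty (hS : S.Nonempty) : (argminSet S f).Nonempty := by
  obtain ⟨j, hj, h⟩ := S.exists_min_image f hS
  exact ⟨j, mem_argminSet.2 ⟨hj, h⟩⟩

end MinOver

section Pull

variable {M : Type u} {sel : Finset M → M} {S : Finset M} {T : M → ℕ}

lemma le_pullFrom (j : M) : T j ≤ pullFrom sel S T j := by
  classical
  unfold pullFrom
  split_ifs
  · by_cases h : j = sel S
    · subst h; simp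
    · simp [h]
  · exact le_rfl

lemma pullFrom_sel (hS : S.Nonempty) : T (sel S) + 1 ≤ pullFrom sel S T (sel S) := by
  simp [pullFrom, hS]

lemma sum_pullFrom_le (Q : Finset M) : ∑ j ∈ Q, pullFrom sel S T j ≤ ∑ j ∈ Q, T j + 1 := by
  classical
  unfold pullFrom
  split_ifs
  · by_cases h : sel S ∈ Q
    · rw [← Finset.add_sum_erase _ _ h, ← Finset.add_sum_erase _ T h]
      have : ∑ j ∈ Q.erase (sel S), Function.update T (sel S) (T (sel S) + 1) j
          = ∑ j ∈ Q.erase (sel S), T j :=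
        Finset.sum_congr rfl fun j hj => by simp [Finset.ne_of_mem_erase hj]
      simp only [Function.update_self]
      convert (show _ ≤ _ from le_of_eq _) using 1
      simp only [this.symm]
      grind
    · refine le_trans (le_of_eq (Finset.sum_congr rfl fun j hj => ?_)) (Nat.le_succ _)
      have : j ≠ sel S := by rintro rfl; exact h hj
      simp [this]
  · exact Nat.le_succ _

end Pull

/-! ### Identify-Cover on the event that the widths are valid -/

section IdentifyCover

variable {M : Type u} {sel : Finset M → M} {δ : ℝ} {Q : Finset M} {i : ℤ} {y : M → ℕ → ℝ}
  {d : M → ℝ} {T : M → ℕ}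

/-- The confidence widths `C_δ` are valid for all points of `Q` at all times. -/
def WidthsValid (δ : ℝ) (Q : Finset M) (y : M → ℕ → ℝ) (d : M → ℝ) : Prop :=
  ∀ j ∈ Q, ∀ t : ℕ, 1 ≤ t → |(∑ s ∈ Finset.range t, y j s) / t - d j| ≤ confWidth δ t

lemma WidthsValid.mono {Q' : Finset M} (h : WidthsValid δ Q y d) (hQ : Q' ⊆ Q) :
    WidthsValid δ Q' y d := fun j hj => h j (hQ hj)

lemma WidthsValid.lcb_le (h : WidthsValid δ Q y d) {j : M} (hj : j ∈ Q) (hT : 1 ≤ T j) :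
    lcb δ y T j ≤ d j := by
  have := (abs_le.1 (h j hj (T j) hT)).2
  unfold lcb empMean; linarith

lemma WidthsValid.le_ucb (h : WidthsValid δ Q y d) {j : M} (hj : j ∈ Q) (hT : 1 ≤ T j) :
    d j ≤ ucb δ y T j := by
  have := (abs_le.1 (h j hj (T j) hT)).1
  unfold ucb empMean; linarith

lemma ucb_eq (j : M) : ucb δ y T j = lcb δ y T j + 2 * confWidth δ (T j) := by
  unfold ucb lcb; ring

lemma le_icStep (j : M) : T j ≤ icStep sel δ Q i y T j :=
  (le_pullFrom j).trans ((le_pullFrom j).trans (le_pullFrom j))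

open Classical in
lemma sum_icStep_le : ∑ j ∈ Q, icStep sel δ Q i y T j ≤ ∑ j ∈ Q, T j + 3 := by
  unfold icStep
  refine (sum_pullFrom_le Q).trans ?_
  have h1 := sum_pullFrom_le (sel := sel)
    (S := argmaxSet ((Q \ icEmpCover Q i y T) \ icKnown δ Q i y T) (lcb (δ / Q.card) y T))
    (T := pullFrom sel (argminSet (icEmpCover Q i y T \ icKnown δ Q i y T)
      (ucb (δ / Q.card) y T)) T) Q
  have h2 := sum_pullFrom_le (sel := sel) (S := argminSet (icEmpCover Q i y T \ icKnown δ Q i y T)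
      (ucb (δ / Q.card) y T)) (T := T) Q
  omega

lemma exists_lcb_min_query (hQ : Q.Nonempty) (hsel : ∀ S : Finset M, S.Nonempty → sel S ∈ S) :
    ∃ j ∈ Q, (∀ k ∈ Q, lcb (δ / Q.card) y T j ≤ lcb (δ / Q.card) y T k) ∧
      T j + 1 ≤ icStep sel δ Q i y T j := by
  have hne := argminSet_nonempty (f := lcb (δ / Q.card) y T) hQ
  obtain ⟨h1, h2⟩ := mem_argminSet.1 (hsel _ hne)
  refine ⟨_, h1, h2, ?_⟩
  exact le_trans (Nat.succ_le_succ ((le_pullFrom _).trans (le_pullFrom _))) (pullFrom_sel hne)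

lemma exists_unknown_query (hsel : ∀ S : Finset M, S.Nonempty → sel S ∈ S)
    (hK : icKnown δ Q i y T ≠ Q) :
    ∃ j ∈ Q, j ∉ icKnown δ Q i y T ∧ T j + 1 ≤ icStep sel δ Q i y T j := by
  classical
  have hKQ : icKnown δ Q i y T ⊆ Q := Finset.filter_subset _ _
  obtain ⟨p, hp, hpK⟩ : ∃ p ∈ Q, p ∉ icKnown δ Q i y T := by
    by_contra! h
    exact hK (Finset.Subset.antisymm hKQ h)
  have hGQ : icEmpCover Q i y T ⊆ Q := Finset.filter_subset _ _
  by_cases hG : p ∈ icEmpCover Q i y T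
  · have hne := argminSet_nonempty (f := ucb (δ / Q.card) y T)
      (⟨p, Finset.mem_sdiff.2 ⟨hG, hpK⟩⟩ :
        (icEmpCover Q i y T \ icKnown δ Q i y T).Nonempty)
    have h1 := Finset.mem_sdiff.1 (mem_argminSet.1 (hsel _ hne)).1
    exact ⟨_, hGQ h1.1, h1.2,
      (pullFrom_sel hne).trans ((le_pullFrom _).trans (le_pullFrom _))⟩
  · have hne := argminSet_nonempty (f := fun j => -lcb (δ / Q.card) y T j)
      (⟨p, Finset.mem_sdiff.2 ⟨Finset.mem_sdiff.2 ⟨hp, hG⟩, hpK⟩⟩ :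
        ((Q \ icEmpCover Q i y T) \ icKnown δ Q i y T).Nonempty)
    have h1 := Finset.mem_sdiff.1 (mem_argminSet.1 (hsel _ hne)).1
    refine ⟨_, (Finset.mem_sdiff.1 h1.1).1, h1.2, ?_⟩
    exact le_trans (Nat.succ_le_succ (le_pullFrom _)) ((pullFrom_sel hne).trans (le_pullFrom _))

/-- The scale that governs the number of queries of `j` in a call of Identify-Cover at level `i`:
the larger of `2 ^ i` and the excess of `d j` over the smallest distance. -/
noncomputable def coverGap (d : M → ℝ) (i : ℤ) (Q : Finset M) (j : M) : ℝ :=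
  max ((2 : ℝ) ^ i) (d j - minOver Q d)

lemma coverGap_pos (j : M) : 0 < coverGap d i Q j :=
  lt_of_lt_of_le (by positivity) (le_max_left _ _)

/-- Whenever Identify-Cover has not finished, one of the points that it queries has a wide
confidence interval. Otherwise the point with the smallest lower confidence bound lies close to
the minimum, so that the thresholds are known up to a fraction of `2 ^ i`; as the two thresholds
overlap by `2 ^ (i - 1)`, every queried point would then be known. -/
lemma exists_wide_query (hQ : Q.Nonempty) (hsel : ∀ S : Finset M, S.Nonempty → sel S ∈ S)
    (hv : WidthsValid (δ / Q.card) Q y d) (hT : ∀ j ∈ Q, 1 ≤ T j)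
    (hK : icKnown δ Q i y T ≠ Q) :
    ∃ j ∈ Q, T j + 1 ≤ icStep sel δ Q i y T j ∧
      coverGap d i Q j / 20 < confWidth (δ / Q.card) (T j) := by
  by_contra! hno
  obtain ⟨m, hm, hmin, hmq⟩ := exists_lcb_min_query (δ := δ) (i := i) (y := y) (T := T) hQ hsel
  obtain ⟨j, hj, hjK, hjq⟩ := exists_unknown_query hsel hK
  have hwm := hno m hm hmq
  have hwj := hno j hj hjq
  obtain ⟨a, ha, haD⟩ := exists_minOver_eq (f := d) hQ
  set D := minOver Q d with hD
  have hDm : D ≤ d m := minOver_le hm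
  have hDj : D ≤ d j := minOver_le hj
  set e : ℝ := (2 : ℝ) ^ i with he
  have he0 : 0 < e := by positivity
  have he2 : (2 : ℝ) ^ (i - 1) = e / 2 := by rw [zpow_sub_one₀ (by norm_num), he]; ring
  have hlm : lcb (δ / Q.card) y T m ≤ D :=
    (hmin a ha).trans ((hv.lcb_le ha (hT a ha)).trans haD.ge)
  have hum := hv.le_ucb hm (hT m hm)
  rw [ucb_eq] at hum
  -- `d m - D ≤ 2 w_m` rules out that the gap of `m` exceeds `2 ^ i`
  have hgm : coverGap d i Q m = e := by
    unfold coverGap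
    rw [← hD, ← he]
    refine max_eq_left ?_
    by_contra! hlt
    unfold coverGap at hwm
    rw [← hD, ← he, max_eq_right hlt.le] at hwm
    linarith
  rw [hgm] at hwm
  have hlow : minOver Q (lcb (δ / Q.card) y T) = lcb (δ / Q.card) y T m := by
    obtain ⟨k, hk, hke⟩ := exists_minOver_eq (f := lcb (δ / Q.card) y T) hQ
    exact le_antisymm (minOver_le hm) (hke ▸ hmin k hk)
  have hupp : minOver Q (ucb (δ / Q.card) y T) ≤ ucb (δ / Q.card) y T m := minOver_le hm
  rw [ucb_eq] at hupp
  have hlj := hv.lcb_le hj (hT j hj)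
  have huj := hv.le_ucb hj (hT j hj)
  rw [ucb_eq] at huj
  apply hjK
  rw [icKnown, Finset.mem_filter]
  refine ⟨hj, ?_⟩
  -- split in the middle of the overlap of the two thresholds, `D + e` and `D + 3 e / 2`
  rcases le_or_gt (d j - D) (5 / 4 * e) with hnear | hfar
  · right
    have : coverGap d i Q j ≤ 5 / 4 * e := max_le (by linarith) hnear
    rw [icLower, hlow, he2, ucb_eq]
    linarith
  · left
    have : coverGap d i Q j = d j - D := max_eq_right (by linarith)
    rw [this] at hwj
    rw [icUpper]
    linarith

/-- On the event that the widths are valid Identify-Cover terminates, its output lies between the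
cover sets of radii `2 ^ i` and `2 ^ i + 2 ^ (i - 1)`, and the number of queries is bounded. -/
lemma identifyCover_spec (hQ : Q.Nonempty) (hsel : ∀ S : Finset M, S.Nonempty → sel S ∈ S)
    (hv : WidthsValid (δ / Q.card) Q y d) (hδ : 0 < δ / Q.card) (hδ' : δ / Q.card ≤ 1 / 12) :
    ∃ r, identifyCover sel δ Q i y = some r ∧
      (∀ j ∈ Q, d j ≤ minOver Q d + 2 ^ i → j ∈ r.1) ∧
      (∀ j ∈ r.1, j ∈ Q ∧ d j ≤ minOver Q d + 2 ^ i + 2 ^ (i - 1)) ∧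
      r.2 ≤ 4 * ∑ j ∈ Q, sampleBound (δ / Q.card) (coverGap d i Q j / 20) := by
  classical
  set N : M → ℕ := fun j => sampleBound (δ / Q.card) (coverGap d i Q j / 20) with hN
  have hN1 : ∀ j, 1 ≤ N j := fun j => sampleBound_pos hδ hδ'
  -- each round makes at most three queries and increases this potential, which is at most `∑ N j`
  set Φ : (M → ℕ) → ℕ := fun T => ∑ j ∈ Q, min (T j) (N j) with hΦ
  have hΦB : ∀ T, Φ T ≤ ∑ j ∈ Q, N j := fun T => Finset.sum_le_sum fun j _ => min_le_right _ _
  obtain ⟨T, hT, ⟨hT1, hTs⟩, hdone⟩ := whileLoop_spec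
    (done := fun T => icKnown δ Q i y T = Q) (step := icStep sel δ Q i y) (s := fun _ => 1)
    (fun T => (∀ j ∈ Q, 1 ≤ T j) ∧ ∑ j ∈ Q, T j ≤ Q.card + 3 * Φ T) Φ (∑ j ∈ Q, N j)
    ⟨fun _ _ => le_rfl, by simp⟩
    (by
      rintro T ⟨hT1, hTs⟩ hK
      obtain ⟨j, hj, hq, hw⟩ := exists_wide_query hQ hsel hv hT1 hK
      have hlt : T j < N j := by
        by_contra! hle
        exact absurd (confWidth_le_of_sampleBound_le hδ hδ'
          (by have := coverGap_pos (d := d) (i := i) (Q := Q) j; positivity) hle) (not_le.2 hw)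
      have hinc : Φ T + 1 ≤ Φ (icStep sel δ Q i y T) := by
        refine Finset.sum_lt_sum (fun k _ => min_le_min_right _ (le_icStep k)) ⟨j, hj, ?_⟩
        rw [min_eq_left hlt.le]
        exact lt_min (by omega) hlt
      refine ⟨⟨fun k hk => (hT1 k hk).trans (le_icStep k), ?_⟩, hinc⟩
      have := sum_icStep_le (sel := sel) (δ := δ) (Q := Q) (i := i) (y := y) (T := T)
      omega)
    (fun T _ => hΦB T)
  refine ⟨_, by rw [identifyCover, hT]; rfl, ?_, ?_, ?_⟩
  · intro j hj hdj
    rw [Finset.mem_filter]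
    refine ⟨hj, ?_⟩
    have hjK : j ∈ icKnown δ Q i y T := by rw [hdone]; exact hj
    rw [icKnown, Finset.mem_filter] at hjK
    refine hjK.2.resolve_left (not_lt.2 ?_)
    obtain ⟨k, hk, hke⟩ := exists_minOver_eq (f := ucb (δ / Q.card) y T) hQ
    have h1 := hv.lcb_le hj (hT1 j hj)
    have h2 := hv.le_ucb hk (hT1 k hk)
    have h3 := minOver_le (f := d) hk
    rw [icUpper, hke]
    linarith
  · intro j hj
    rw [Finset.mem_filter] at hj
    refine ⟨hj.1, ?_⟩
    obtain ⟨k, hk, hke⟩ := exists_minOver_eq (f := d) hQ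
    have h1 := hv.le_ucb hj.1 (hT1 j hj.1)
    have h2 := hv.lcb_le hk (hT1 k hk)
    have h3 := minOver_le (f := lcb (δ / Q.card) y T) hk
    have h4 := hj.2
    rw [icLower] at h4
    linarith
  · have h1 : Q.card ≤ ∑ j ∈ Q, N j := by
      rw [Finset.card_eq_sum_ones]
      exact Finset.sum_le_sum fun j _ => hN1 j
    have h2 := hΦB T
    show ∑ j ∈ Q, T j ≤ 4 * ∑ j ∈ Q, N j
    omega

end IdentifyCover

/-! ### find-smallest-in-set on the event that the widths are valid -/

section FindSmallest

variable {M : Type u} {sel : Finset M → M} {n : ℕ} {δ : ℝ} {Q : Finset M} {y : M → ℕ → ℝ}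
  {d : M → ℝ} {T : M → ℕ}

lemma mem_fsActive_of_isMin (hv : WidthsValid (δ / n) Q y d) (hT : ∀ j ∈ Q, 1 ≤ T j) {x : M}
    (hx : x ∈ Q) (hmin : ∀ j ∈ Q, d x ≤ d j) : x ∈ fsActive n δ Q y T := by
  rw [fsActive, Finset.mem_filter]
  refine ⟨hx, not_lt.2 ?_⟩
  obtain ⟨k, hk, hke⟩ := exists_minOver_eq (f := ucb (δ / n) y T) ⟨x, hx⟩
  rw [hke]
  exact (hv.lcb_le hx (hT x hx)).trans ((hmin k hk).trans (hv.le_ucb hk (hT k hk)))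

lemma lt_sampleBound_of_mem_fsActive (hv : WidthsValid (δ / n) Q y d) (hδ : 0 < δ / n)
    (hδ' : δ / n ≤ 1 / 12) (hT : ∀ j ∈ Q, 1 ≤ T j) {x j : M} (hx : x ∈ Q)
    (hTx : T j ≤ T x) (hlt : d x < d j) (hj : j ∈ fsActive n δ Q y T) :
    T j < sampleBound (δ / n) ((d j - d x) / 20) := by
  by_contra! hle
  rw [fsActive, Finset.mem_filter, not_lt] at hj
  have hg : 0 < (d j - d x) / 20 := by linarith
  have hwj := confWidth_le_of_sampleBound_le hδ hδ' hg hle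
  have hwx := confWidth_le_of_sampleBound_le hδ hδ' hg (hle.trans hTx)
  have h1 := hv.le_ucb hj.1 (hT j hj.1)
  have h2 := hv.lcb_le hx (hT x hx)
  have h3 := minOver_le (f := ucb (δ / n) y T) hx
  rw [ucb_eq] at h1 h3
  linarith [hj.2]

open Classical in
/-- On the event that the widths are valid find-smallest-in-set returns the minimizer. A point
`j ≠ x` that is active has been queried at most as often as `x`, so it is never queried once the
width at `T j` is a small fraction of its gap; and each query of `x` comes with a query of some
other point. -/
lemma findSmallest_spec (hsel : ∀ S : Finset M, S.Nonempty → sel S ∈ S)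
    (hv : WidthsValid (δ / n) Q y d) (hδ : 0 < δ / n) (hδ' : δ / n ≤ 1 / 12) {x : M} (hx : x ∈ Q)
    (hmin : ∀ j ∈ Q, j ≠ x → d x < d j) :
    ∃ r, findSmallest sel n δ Q y = some r ∧ r.1 = x ∧
      r.2 ≤ 1 + 2 * ∑ j ∈ Q.erase x, sampleBound (δ / n) ((d j - d x) / 20) := by
  have hmin' : ∀ j ∈ Q, d x ≤ d j := fun j hj => by
    rcases eq_or_ne j x with rfl | h
    · exact le_rfl
    · exact (hmin j hj h).le
  by_cases hcard : Q.card = 1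
  · refine ⟨(sel Q, 0), by simp [findSmallest, hcard], ?_, Nat.zero_le _⟩
    exact Finset.card_le_one.1 hcard.le _ (hsel Q ⟨x, hx⟩) _ hx
  set N : M → ℕ := fun j => sampleBound (δ / n) ((d j - d x) / 20) with hN
  set Φ : (M → ℕ) → ℕ := fun T => ∑ j ∈ Q.erase x, T j with hΦ
  obtain ⟨T, hT, ⟨hT1, hTx, hTN, hTs⟩, hdone⟩ := whileLoop_spec
    (done := fun T => (fsActive n δ Q y T).card ≤ 1) (step := fsStep n δ Q y) (s := fun _ => 1)
    (fun T => (∀ j ∈ Q, 1 ≤ T j) ∧ (∀ j ∈ Q, T j ≤ T x) ∧ (∀ j ∈ Q.erase x, T j ≤ N j) ∧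
      T x ≤ 1 + Φ T) Φ (∑ j ∈ Q.erase x, N j)
    ⟨fun _ _ => le_rfl, fun _ _ => le_rfl, fun _ _ => sampleBound_pos hδ hδ', by simp⟩
    (by
      rintro T ⟨hT1, hTx, hTN, hTs⟩ hnd
      have hxa := mem_fsActive_of_isMin hv hT1 hx hmin'
      obtain ⟨j, hja, hjx⟩ := Finset.exists_mem_ne (not_le.1 hnd) x
      have hjQ : j ∈ Q := (Finset.mem_filter.1 hja).1
      have hle : ∀ k, T k ≤ fsStep n δ Q y T k := fun k => by
        unfold fsStep; split_ifs <;> omega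
      have hle' : ∀ k, fsStep n δ Q y T k ≤ T k + 1 := fun k => by
        unfold fsStep; split_ifs <;> omega
      have hxs : fsStep n δ Q y T x = T x + 1 := by simp [fsStep, hxa]
      have hinc : Φ T + 1 ≤ Φ (fsStep n δ Q y T) := by
        refine Finset.sum_lt_sum (fun k _ => hle k) ⟨j, Finset.mem_erase.2 ⟨hjx, hjQ⟩, ?_⟩
        simp [fsStep, hja]
      refine ⟨⟨fun k hk => (hT1 k hk).trans (hle k), fun k hk => ?_, fun k hk => ?_, ?_⟩, hinc⟩
      · have := hle' k
        have := hTx k hk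
        omega
      · obtain ⟨hkx, hkQ⟩ := Finset.mem_erase.1 hk
        by_cases hka : k ∈ fsActive n δ Q y T
        · have h1 : T k < N k := lt_sampleBound_of_mem_fsActive hv hδ hδ' hT1 hx (hTx k hkQ)
            (hmin k hkQ hkx) hka
          have := hle' k
          omega
        · simp only [fsStep, if_neg hka]
          exact hTN k hk
      · omega)
    (fun T hI => Finset.sum_le_sum hI.2.2.1)
  refine ⟨(sel (fsActive n δ Q y T), ∑ j ∈ Q, T j), by simp [findSmallest, hcard, hT], ?_, ?_⟩
  · have hxa := mem_fsActive_of_isMin hv hT1 hx hmin'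
    exact Finset.card_le_one.1 hdone _ (hsel _ ⟨x, hxa⟩) _ hxa
  · have h1 : Φ T ≤ ∑ j ∈ Q.erase x, N j := Finset.sum_le_sum hTN
    have h2 : T x + Φ T = ∑ j ∈ Q, T j := Finset.add_sum_erase _ _ hx
    show ∑ j ∈ Q, T j ≤ 1 + 2 * ∑ j ∈ Q.erase x, N j
    omega

end FindSmallest

/-! ### Cover trees -/

section Tree

variable {M : Type u} [MetricSpace M] {X : Finset M} (T : CoverTree X)

lemma CoverTree.level_anti {i j : ℤ} (h : j ≤ i) : T.level i ⊆ T.level j := by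
  obtain ⟨m, rfl⟩ : ∃ m : ℕ, j = i - m := ⟨(i - j).toNat, by omega⟩
  clear h
  induction m with
  | zero => simp
  | succ m ih =>
    refine ih.trans ?_
    have := T.nesting (i - m)
    rwa [show i - (m : ℤ) - 1 = i - ((m + 1 : ℕ) : ℤ) by push_cast; ring] at this

lemma CoverTree.mem_childrenOf {i : ℤ} {Q : Finset M} {p : M} :
    p ∈ T.childrenOf i Q ↔ p ∈ T.level (i - 1) ∧ T.parent i p ∈ Q := by
  simp [CoverTree.childrenOf]

lemma CoverTree.subset_childrenOf {i : ℤ} {Q : Finset M} (hQ : Q ⊆ T.level i) :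
    Q ⊆ T.childrenOf i Q := fun p hp =>
  T.mem_childrenOf.2 ⟨T.nesting i (hQ hp), by rwa [T.parent_self i p (hQ hp)]⟩

/-- The ancestor of `x` at level `bot + m`. -/
def CoverTree.ancestor {M : Type u} [MetricSpace M] {X : Finset M} (T : CoverTree X) (x : M) :
    ℕ → M
  | 0 => x
  | m + 1 => T.parent (T.bot + m + 1) (CoverTree.ancestor T x m)

lemma CoverTree.ancestor_mem {x : M} (hx : x ∈ X) (m : ℕ) :
    T.ancestor x m ∈ T.level (T.bot + m) := by
  induction m with
  | zero => simpa [CoverTree.ancestor, T.level_bot] using hx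
  | succ m ih =>
    have := T.parent_mem (T.bot + m + 1) (T.ancestor x m)
      (by rwa [show T.bot + (m : ℤ) + 1 - 1 = T.bot + m by ring])
    push_cast
    rwa [← add_assoc]

lemma CoverTree.dist_ancestor_le {x : M} (hx : x ∈ X) (m : ℕ) :
    dist x (T.ancestor x m) ≤ (2 : ℝ) ^ (T.bot + m + 1) := by
  induction m with
  | zero => simp [CoverTree.ancestor]; positivity
  | succ m ih =>
    have h1 := T.covering (T.bot + m + 1) (T.ancestor x m)
      (by rw [show T.bot + (m : ℤ) + 1 - 1 = T.bot + m by ring]; exact T.ancestor_mem hx m)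
    have h2 := dist_triangle x (T.ancestor x m) (T.ancestor x (m + 1))
    have h3 : (2 : ℝ) ^ (T.bot + ((m + 1 : ℕ) : ℤ) + 1) = 2 * 2 ^ (T.bot + m + 1) := by
      push_cast
      rw [show T.bot + ((m : ℤ) + 1) + 1 = (T.bot + m + 1) + 1 by ring,
        zpow_add_one₀ (by norm_num)]
      ring
    rw [h3]
    change dist _ _ ≤ _ at h1
    have h4 : dist (T.ancestor x m) (T.ancestor x (m + 1)) ≤ (2 : ℝ) ^ (T.bot + m + 1) := h1
    linarith

/-- A set of nodes of level `i - 1` close to `q` is small. If `q` is nearer to `X` than `2 ^ i`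
this is the packing bound; otherwise all these nodes lie in a ball about `q` that is only a
constant factor larger than one without points of `X`. -/
lemma CoverTree.card_cover_le {q : M} {r : ℝ} (hr : ∀ x ∈ X, r ≤ dist q x) {i : ℤ} {P : Finset M}
    (hP : P ⊆ T.level (i - 1)) (hd : ∀ p ∈ P, dist q p ≤ r + 5 / 2 * 2 ^ i) :
    (P.card : ℝ) ≤ expansionConst (insert q (X : Set M)) ^ 5 := by
  have hS : (insert q (X : Set M)).Finite := X.finite_toSet.insert q
  have hc := two_le_expansionConst hS
  have hPX : (P : Set M) ⊆ insert q (X : Set M) := fun p hp =>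
    Set.mem_insert_of_mem _ (T.level_subset _ (hP hp))
  have he : (0 : ℝ) < 2 ^ i := by positivity
  have he2 : (2 : ℝ) ^ (i - 1) = 2 ^ i / 2 := by rw [zpow_sub_one₀ (by norm_num)]; ring
  rcases le_or_gt r (2 ^ i) with h | h
  · refine card_le_of_separated hS hPX (z := q) (ρ := 7 / 2 * 2 ^ i) (r := 2 ^ i / 4)
      (by positivity) 5 (by linarith) (fun p hp p' hp' hne => ?_)
      fun p hp => (hd p hp).trans (by linarith)
    have := T.separation _ p (hP hp) p' (hP hp') hne
    rw [he2] at this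
    linarith
  · have h1 := ncard_closedBall_le_of_isolated hS (Set.mem_insert q _) (r := r) (by linarith)
      (fun x hx hne => hr x (by simpa [hne] using hx))
    have h2 : (P.card : ℝ) ≤ (insert q (X : Set M) ∩ Metric.closedBall q (7 / 2 * r)).ncard := by
      rw [← Set.ncard_coe_finset]
      refine Nat.cast_le.2 (Set.ncard_le_ncard (fun p hp => ⟨hPX hp, ?_⟩) (hS.inter_of_left _))
      rw [Metric.mem_closedBall, dist_comm]
      exact (hd p hp).trans (by linarith)
    exact h2.trans (h1.trans (pow_le_pow_right₀ (by linarith) (by norm_num)))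

lemma CoverTree.card_childrenOf_le (q : M) {i : ℤ} {P : Finset M} :
    ((T.childrenOf i P).card : ℝ) ≤ expansionConst (insert q (X : Set M)) ^ 4 * P.card := by
  classical
  have hS : (insert q (X : Set M)).Finite := X.finite_toSet.insert q
  have he : (0 : ℝ) < 2 ^ i := by positivity
  have he2 : (2 : ℝ) ^ (i - 1) = 2 ^ i / 2 := by rw [zpow_sub_one₀ (by norm_num)]; ring
  have hmaps : Set.MapsTo (T.parent i) (T.childrenOf i P) P :=
    fun p hp => (T.mem_childrenOf.1 hp).2
  rw [Finset.card_eq_sum_card_fiberwise hmaps]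
  push_cast
  calc _ ≤ ∑ p ∈ P, expansionConst (insert q (X : Set M)) ^ 4 := by
        refine Finset.sum_le_sum fun p _ => ?_
        have hsub : ∀ j ∈ (T.childrenOf i P).filter (fun j => T.parent i j = p),
            j ∈ T.level (i - 1) ∧ T.parent i j = p := fun j hj =>
          ⟨(T.mem_childrenOf.1 (Finset.mem_filter.1 hj).1).1, (Finset.mem_filter.1 hj).2⟩
        refine card_le_of_separated hS
          (fun j hj => Set.mem_insert_of_mem _ (T.level_subset _ (hsub j hj).1)) (z := p)
          (ρ := 2 ^ i) (r := 2 ^ i / 4) (by positivity) 4 (by linarith)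
          (fun j hj j' hj' hne => ?_) fun j hj => ?_
        · have := T.separation _ j (hsub j hj).1 j' (hsub j' hj').1 hne
          rw [he2] at this
          linarith
        · have := T.covering i j (hsub j hj).1
          rw [(hsub j hj).2, dist_comm] at this
          exact this
    _ = _ := by rw [Finset.sum_const, nsmul_eq_mul, mul_comm]

end Tree

/-! ### The number of calls of Identify-Cover -/

/-- Along a sequence of levels `a` (from the lowest to the highest) let `p t`, `z t` be points such
that `z t` has distance at least `2 ^ (a t - 2)` from `q`, and both are within
`r + 3 * 2 ^ a (t + 1)` of `q`, where `r` bounds from below the distance from `q` to the other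
points. Then the sequence has `O(c² log n)` terms. While `3 * 2 ^ a (t + 1) ≤ r` the distinct points
`p t` all lie in a ball about `q` with at most `c²` points. From then on eight steps multiply the
number of points within `8 * 2 ^ a t` of `q` by `1 + c⁻²`. -/
lemma length_le_of_annuli {M : Type u} [MetricSpace M] {S : Set M} (hS : S.Finite) {q : M}
    (hq : q ∈ S) {r : ℝ} (hr : ∀ x ∈ S, x ≠ q → r ≤ dist q x) {n : ℕ} (hn : 2 ≤ n)
    (hSn : S.ncard ≤ n + 1) (m : ℕ) (a : ℕ → ℤ) (p z : ℕ → M)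
    (hmono : ∀ t, t + 1 < m → a t < a (t + 1))
    (hpS : ∀ t < m, p t ∈ S) (hzS : ∀ t < m, z t ∈ S)
    (hinj : ∀ t < m, ∀ t' < m, p t = p t' → t = t')
    (hz : ∀ t < m, (2 : ℝ) ^ a t / 4 ≤ dist q (z t))
    (hpu : ∀ t, t + 1 < m → dist q (p t) ≤ r + 3 * 2 ^ a (t + 1))
    (hzu : ∀ t, t + 1 < m → dist q (z t) ≤ r + 3 * 2 ^ a (t + 1)) :
    (m : ℝ) ≤ 25 * expansionConst S ^ 2 * Real.log n := by
  classical
  have hc := two_le_expansionConst hS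
  set c := expansionConst S with hcdef
  have hadd : ∀ k t, t + k < m → a t + k ≤ a (t + k) := by
    intro k
    induction k with
    | zero => intro t _; simp
    | succ k ih =>
      intro t ht
      have h1 := ih t (by omega)
      have h2 := hmono (t + k) (by omega)
      rw [← add_assoc]
      push_cast
      omega
  -- `t₀` is the number of calls at scales far below `r`
  set P : ℕ → Prop := fun t => t + 1 < m ∧ 3 * (2 : ℝ) ^ a (t + 1) ≤ r with hP
  have hex : ∃ t, ¬ P t := ⟨m, fun h => by have := h.1; omega⟩
  set t₀ := Nat.find hex with ht₀
  have hlow : ∀ t < t₀, P t := fun t ht => not_not.1 (Nat.find_min hex ht)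
  have hhigh : ∀ t, t₀ ≤ t → t + 1 < m → r < 3 * (2 : ℝ) ^ a (t + 1) := by
    intro t ht htm
    have h1 := Nat.find_spec hex
    have h2 : r < 3 * (2 : ℝ) ^ a (t₀ + 1) := by
      by_contra! h
      exact h1 ⟨by omega, h⟩
    have h3 : a (t₀ + 1) ≤ a (t + 1) := by
      have := hadd (t - t₀) (t₀ + 1) (by omega)
      rw [show t₀ + 1 + (t - t₀) = t + 1 by omega] at this
      omega
    have h4 : (2 : ℝ) ^ a (t₀ + 1) ≤ 2 ^ a (t + 1) := zpow_le_zpow_right₀ (by norm_num) h3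
    linarith
  have ht₀c : (t₀ : ℝ) ≤ c ^ 2 := by
    rcases Nat.eq_zero_or_pos t₀ with h0 | h0
    · rw [h0]; simp; positivity
    have hr0 : 0 < r := lt_of_lt_of_le (by positivity) (hlow 0 h0).2
    refine le_trans ?_ (ncard_closedBall_le_of_isolated hS hq hr0 hr)
    have hcard : ((Finset.range t₀).image p).card = t₀ := by
      rw [Finset.card_image_of_injOn, Finset.card_range]
      intro t ht t' ht' h
      have h1 := (hlow t (Finset.mem_range.1 ht)).1
      have h2 := (hlow t' (Finset.mem_range.1 ht')).1
      exact hinj t (by omega) t' (by omega) h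
    rw [← hcard, ← Set.ncard_coe_finset]
    refine Nat.cast_le.2 (Set.ncard_le_ncard ?_ (hS.inter_of_left _))
    intro x hx
    obtain ⟨t, ht, rfl⟩ := Finset.mem_image.1 hx
    have h1 := hlow t (Finset.mem_range.1 ht)
    refine ⟨hpS t (by have := h1.1; omega), ?_⟩
    rw [Metric.mem_closedBall, dist_comm]
    have h2 := hpu t h1.1
    have h3 := h1.2
    linarith
  set g : ℕ → ℝ := fun t => (S ∩ Metric.closedBall q (8 * 2 ^ a t)).ncard with hg
  have hstep : ∀ t, t₀ ≤ t → t + 8 < m → (1 + (c ^ 2)⁻¹) * g t ≤ g (t + 8) := by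
    intro t ht htm
    have h1 := hhigh (t + 7) (by omega) (by omega)
    have h2 := hzu (t + 7) (by omega)
    have h3 := hz (t + 7) (by omega)
    have h4 := hadd 7 t (by omega)
    have h5 : (2 : ℝ) ^ a t * 128 ≤ 2 ^ a (t + 7) := by
      calc (2 : ℝ) ^ a t * 128 = 2 ^ (a t + 7) := by
            rw [zpow_add₀ (by norm_num)]; norm_num
        _ ≤ _ := zpow_le_zpow_right₀ (by norm_num) h4
    have h6 : (0 : ℝ) < 2 ^ a t := by positivity
    have hgr := ncard_closedBall_growth hS (q := q) (hzS (t + 7) (by omega)) (by linarith)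
    have h7 : g t ≤ (S ∩ Metric.closedBall q (dist q (z (t + 7)) / 3)).ncard :=
      ncard_inter_closedBall_mono hS (by rw [dist_self]; linarith)
    have h8 : ((S ∩ Metric.closedBall q (4 * dist q (z (t + 7)) / 3)).ncard : ℝ) ≤ g (t + 8) :=
      ncard_inter_closedBall_mono hS (by
        rw [dist_self]
        rw [show t + 7 + 1 = t + 8 by ring] at h1 h2
        linarith)
    refine le_trans ?_ (hgr.trans h8)
    gcongr
  have hpow : ∀ w : ℕ, t₀ + 8 * w < m → (1 + (c ^ 2)⁻¹) ^ w ≤ g (t₀ + 8 * w) := by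
    intro w
    induction w with
    | zero =>
      intro _
      simp only [pow_zero, hg]
      have : 0 < (S ∩ Metric.closedBall q (8 * 2 ^ a (t₀ + 8 * 0))).ncard :=
        (Set.ncard_pos (hS.inter_of_left _)).2
          ⟨q, hq, Metric.mem_closedBall_self (by positivity)⟩
      exact_mod_cast this
    | succ w ih =>
      intro hw
      have h1 := ih (by omega)
      have h2 := hstep (t₀ + 8 * w) (by omega) (by omega)
      rw [pow_succ', show t₀ + 8 * (w + 1) = t₀ + 8 * w + 8 by ring]
      refine le_trans ?_ h2
      gcongr
  have hn' : (2 : ℝ) ≤ n := by exact_mod_cast hn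
  have hlogn : 2 / 3 ≤ Real.log n := log_two_ge.trans (Real.log_le_log (by norm_num) hn')
  have hmain : (m : ℝ) ≤ c ^ 2 + 8 + 8 * ((c ^ 2 + 1) * (2 * Real.log n)) := by
    rcases le_or_gt m t₀ with h | h
    · have : (m : ℝ) ≤ t₀ := by exact_mod_cast h
      have : 0 ≤ 8 * ((c ^ 2 + 1) * (2 * Real.log n)) := by positivity
      linarith
    set w := (m - 1 - t₀) / 8 with hw
    have h1 := hpow w (by omega)
    have h2 : g (t₀ + 8 * w) ≤ n + 1 := by
      have : (S ∩ Metric.closedBall q (8 * 2 ^ a (t₀ + 8 * w))).ncard ≤ n + 1 :=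
        (Set.ncard_le_ncard Set.inter_subset_left hS).trans hSn
      simp only [hg]
      exact_mod_cast this
    have h3 : w * Real.log (1 + (c ^ 2)⁻¹) ≤ 2 * Real.log n := by
      have e : (2 : ℝ) * Real.log n = Real.log (n ^ 2) := by rw [Real.log_pow]; norm_num
      rw [← Real.log_pow, e]
      refine Real.log_le_log (by positivity) (h1.trans (h2.trans ?_))
      nlinarith
    have h4 : (c ^ 2 + 1)⁻¹ ≤ Real.log (1 + (c ^ 2)⁻¹) := by
      have := Real.one_sub_inv_le_log_of_pos (show 0 < 1 + (c ^ 2)⁻¹ by positivity)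
      have e : 1 - (1 + (c ^ 2)⁻¹)⁻¹ = (c ^ 2 + 1)⁻¹ := by
        field_simp; ring
      rwa [e] at this
    have h5 : (w : ℝ) ≤ (c ^ 2 + 1) * (2 * Real.log n) := by
      have h6 : w * (c ^ 2 + 1)⁻¹ ≤ 2 * Real.log n :=
        (mul_le_mul_of_nonneg_left h4 w.cast_nonneg).trans h3
      rw [← div_eq_mul_inv, div_le_iff₀ (by positivity)] at h6
      linarith
    have h7 : m ≤ t₀ + 8 * w + 8 := by omega
    have h8 : (m : ℝ) ≤ t₀ + 8 * w + 8 := by exact_mod_cast h7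
    linarith
  have hc4 : 4 ≤ c ^ 2 := by nlinarith
  nlinarith

/-! ### The descent on the event that the widths are valid -/

/-- All failure probabilities in use are at most `1 / 12`, as `δ < 1 / 2`, `α ≥ 3`, and `δ / α` is
shared by at least two points. -/
lemma div_alpha_le {M : Type u} {X : Finset M} {δ : ℝ}
    (hX : 2 ≤ X.card) (hδ : 0 < δ) (hδ2 : δ < 1 / 2) {m : ℕ} (hm : 2 ≤ m) :
    0 < δ / alpha X / m ∧ δ / alpha X / m ≤ 1 / 12 := by
  have h1 : (3 : ℝ) ≤ alpha X := by
    unfold alpha; have : (2 : ℝ) ≤ X.card := by exact_mod_cast hX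
    linarith
  have h2 : (2 : ℝ) ≤ m := by exact_mod_cast hm
  refine ⟨by positivity, ?_⟩
  rw [div_div, div_le_iff₀ (by positivity)]
  nlinarith

section Descent

variable {M : Type u} [MetricSpace M] {X : Finset M}

/-- The facts about a call `(i, Q)` of Identify-Cover: `Q` is a small set of nodes of level
`i - 1`, and it holds an explicit node together with its parent. -/
structure IsCall (T : CoverTree X) (q : M) (e : ℤ × Finset M) : Prop where
  subset : e.2 ⊆ T.level (e.1 - 1)
  card_le : (e.2.card : ℝ) ≤ expansionConst (insert q (X : Set M)) ^ 9
  explicit : ∃ p ∈ e.2, p ∉ T.level e.1 ∧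
    ∃ p' ∈ e.2, (2 : ℝ) ^ (e.1 - 1) < dist p p' ∧ dist p p' ≤ 2 ^ e.1

/-- The call `e` comes after the call `e'`: its level is lower, and its nodes are close to `q`
relative to the scale of the call `e'`. -/
def Follows (q : M) (r : ℝ) (e e' : ℤ × Finset M) : Prop :=
  e.1 < e'.1 ∧ ∀ j ∈ e.2, dist q j ≤ r + 3 * 2 ^ e'.1

/-- If a set of nodes of level `i` is not equal to the set of its children, one of the children is
explicit, and its parent is also one of the children. -/
lemma CoverTree.exists_explicit (T : CoverTree X) {i : ℤ} {P : Finset M} (hP : P ⊆ T.level i)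
    (hne : T.childrenOf i P ≠ P) :
    ∃ p ∈ T.childrenOf i P, p ∉ T.level i ∧
      ∃ p' ∈ T.childrenOf i P, (2 : ℝ) ^ (i - 1) < dist p p' ∧ dist p p' ≤ 2 ^ i := by
  have hsub := T.subset_childrenOf hP
  obtain ⟨p, hp, hps⟩ : ∃ p ∈ T.childrenOf i P, p ∉ P := by
    by_contra! h
    exact hne (Finset.Subset.antisymm h hsub)
  obtain ⟨hp1, hp2⟩ := T.mem_childrenOf.1 hp
  have hpp : p ≠ T.parent i p := fun h => hps (h ▸ hp2)
  exact ⟨p, hp, fun h => hpp (T.parent_self i p h).symm, T.parent i p, hsub hp2,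
    T.separation _ p hp1 _ (T.mem_childrenOf.1 (hsub hp2)).1 hpp, T.covering i p hp1⟩

/-- The number of samples of all points of `Q` that a call of Identify-Cover on `(i, Q)` needs, up
to a constant. -/
noncomputable def callCost (q : M) (δ : ℝ) (e : ℤ × Finset M) : ℕ :=
  ∑ j ∈ e.2, sampleBound (δ / e.2.card) (coverGap (dist q) e.1 e.2 j / 20)

/-- The widths are valid in the call of Identify-Cover at stage `k`, if there is one. -/
def StageValid (sel : Finset M → M) (T : CoverTree X) (δ : ℝ) (q : M) (y : ℕ → M → ℕ → ℝ)
    (k : ℕ) : Prop :=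
  ∀ s, descend sel T δ y k = some s → T.childrenOf (T.top - k) s.cover ≠ s.cover →
    WidthsValid (δ / alpha X / (T.childrenOf (T.top - k) s.cover).card)
      (T.childrenOf (T.top - k) s.cover) (y k) (dist q)

/-- The invariant of the descent after `k` stages. -/
structure DescentInv (T : CoverTree X) (δ : ℝ) (q xq : M) (k : ℕ) (s : SearchState M) : Prop where
  subset : s.cover ⊆ T.level (T.top - k)
  ancestor_mem : T.ancestor xq ((T.top - T.bot).toNat - k) ∈ s.cover
  card_le : (s.cover.card : ℝ) ≤ expansionConst (insert q (X : Set M)) ^ 5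
  dist_le : ∀ e ∈ s.trace.head?, T.top - k < e.1 ∧
    ∀ j ∈ s.cover, dist q j ≤ dist q xq + 5 / 2 * 2 ^ e.1
  chain : s.trace.IsChain (Follows q (dist q xq))
  isCall : ∀ e ∈ s.trace, IsCall T q e
  calls_le : s.calls ≤ 4 * (s.trace.map (callCost q (δ / alpha X))).sum

lemma IsCall.two_le_card {T : CoverTree X} {q : M} {e : ℤ × Finset M} (h : IsCall T q e) :
    2 ≤ e.2.card := by
  obtain ⟨p, hp, -, p', hp', hlt, -⟩ := h.explicit
  refine Finset.one_lt_card.2 ⟨p, hp, p', hp', ?_⟩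
  rintro rfl
  rw [dist_self] at hlt
  exact absurd hlt (not_lt.2 (by positivity))

lemma exists_descentInv {sel : Finset M → M} {T : CoverTree X} {δ : ℝ} {q xq : M}
    {y : ℕ → M → ℕ → ℝ} (hsel : ∀ S : Finset M, S.Nonempty → sel S ∈ S) (hX : 2 ≤ X.card)
    (hδ : 0 < δ) (hδ2 : δ < 1 / 2) (hxq : xq ∈ X) (hnn : ∀ x ∈ X, dist q xq ≤ dist q x) {k : ℕ}
    (hk : k ≤ (T.top - T.bot).toNat) (hgood : ∀ l < k, StageValid sel T δ q y l) :
    ∃ s, descend sel T δ y k = some s ∧ DescentInv T δ q xq k s := by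
  classical
  have hS : (insert q (X : Set M)).Finite := X.finite_toSet.insert q
  have hc := two_le_expansionConst hS
  have htb := T.bot_le_top
  induction k with
  | zero =>
    obtain ⟨root, hroot⟩ := T.level_top
    refine ⟨_, rfl, ⟨by simp, ?_, ?_, by simp, by simp, by simp, by simp⟩⟩
    · have := T.ancestor_mem hxq (T.top - T.bot).toNat
      rwa [show T.bot + ((T.top - T.bot).toNat : ℤ) = T.top by omega] at this
    · simp only [hroot, Finset.card_singleton, Nat.cast_one]
      exact one_le_pow₀ (by linarith)
  | succ k ih =>
    obtain ⟨s, hs, hI⟩ := ih (by omega) fun l hl => hgood l (by omega)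
    set i : ℤ := T.top - k with hi
    have hi' : T.top - ((k + 1 : ℕ) : ℤ) = i - 1 := by push_cast; omega
    set Q := T.childrenOf i s.cover with hQ
    -- the ancestor of `xq` at the next level
    set a := T.ancestor xq ((T.top - T.bot).toNat - (k + 1)) with ha
    have hm : (T.top - T.bot).toNat - k = (T.top - T.bot).toNat - (k + 1) + 1 := by omega
    have hlev : T.bot + (((T.top - T.bot).toNat - (k + 1) : ℕ) : ℤ) + 1 = i := by omega
    have hamem : a ∈ T.level (i - 1) := by
      have := T.ancestor_mem hxq ((T.top - T.bot).toNat - (k + 1))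
      rwa [show T.bot + (((T.top - T.bot).toNat - (k + 1) : ℕ) : ℤ) = i - 1 by omega] at this
    have hapar : T.parent i a ∈ s.cover := by
      have := hI.ancestor_mem
      rw [hm, CoverTree.ancestor, hlev] at this
      exact this
    have haQ : a ∈ Q := T.mem_childrenOf.2 ⟨hamem, hapar⟩
    have hda : dist q a ≤ dist q xq + 2 ^ i := by
      have h1 := T.dist_ancestor_le hxq ((T.top - T.bot).toNat - (k + 1))
      rw [hlev] at h1
      exact (dist_triangle q xq a).trans (by linarith)
    have hsub : s.cover ⊆ Q := T.subset_childrenOf hI.subset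
    have hQlev : Q ⊆ T.level (i - 1) := fun p hp => (T.mem_childrenOf.1 hp).1
    have hdesc : descend sel T δ y (k + 1) = if Q = s.cover then some s else
        (identifyCover sel (δ / alpha X) Q i (y k)).map
          fun r => ⟨r.1, s.calls + r.2, (i, Q) :: s.trace⟩ := by
      rw [descend, hs]
      rfl
    by_cases hQs : Q = s.cover
    · refine ⟨s, by rw [hdesc, if_pos hQs], ?_⟩
      refine ⟨by rw [hi', ← hQs]; exact hQlev, by rw [← hQs]; exact haQ, hI.card_le, ?_,
        hI.chain, hI.isCall, hI.calls_le⟩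
      intro e he
      have := hI.dist_le e he
      exact ⟨by rw [hi']; omega, this.2⟩
    · have hcardQ : (Q.card : ℝ) ≤ expansionConst (insert q (X : Set M)) ^ 9 := by
        refine (T.card_childrenOf_le q).trans ?_
        rw [show 9 = 4 + 5 by rfl, pow_add]
        have := hI.card_le
        gcongr
      have hcall : IsCall T q (i, Q) := ⟨hQlev, hcardQ, T.exists_explicit hI.subset hQs⟩
      obtain ⟨h0, h12⟩ := div_alpha_le hX hδ hδ2 hcall.two_le_card
      obtain ⟨r, hr, hr1, hr2, hr3⟩ := identifyCover_spec (i := i) ⟨a, haQ⟩ hsel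
        (hgood k (by omega) s hs hQs) h0 h12
      have hmin : dist q xq ≤ minOver Q (dist q) := by
        obtain ⟨j, hj, hje⟩ := exists_minOver_eq (f := dist q) ⟨a, haQ⟩
        rw [hje]
        exact hnn j (T.level_subset _ (hQlev hj))
      have hmin' : minOver Q (dist q) ≤ dist q a := minOver_le haQ
      have he2 : (2 : ℝ) ^ (i - 1) = 2 ^ i / 2 := by rw [zpow_sub_one₀ (by norm_num)]; ring
      have hr1d : ∀ j ∈ r.1, dist q j ≤ dist q xq + 5 / 2 * 2 ^ i := fun j hj => by
        have := (hr2 j hj).2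
        rw [he2] at this
        linarith
      have hr1s : r.1 ⊆ T.level (i - 1) := fun j hj => hQlev (hr2 j hj).1
      refine ⟨⟨r.1, s.calls + r.2, (i, Q) :: s.trace⟩, by rw [hdesc, if_neg hQs, hr]; rfl, ?_⟩
      refine ⟨by rw [hi']; exact hr1s, hr1 a haQ (by linarith),
        T.card_cover_le hnn hr1s hr1d, ?_, ?_, ?_, ?_⟩
      · intro e he
        obtain rfl : (i, Q) = e := by simpa using he
        exact ⟨by rw [hi']; simp, hr1d⟩
      · rw [List.isChain_cons]
        refine ⟨fun e he => ?_, hI.chain⟩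
        obtain ⟨h1, h2⟩ := hI.dist_le e he
        refine ⟨h1, fun j hj => ?_⟩
        obtain ⟨hj1, hj2⟩ := T.mem_childrenOf.1 hj
        have h3 := h2 _ hj2
        have h4 := T.covering i j hj1
        have h5 := dist_triangle_right q j (T.parent i j)
        have h6 : (2 : ℝ) ^ i ≤ 2 ^ (e.1 - 1) :=
          zpow_le_zpow_right₀ (by norm_num) (Int.le_sub_one_of_lt h1)
        rw [zpow_sub_one₀ (by norm_num)] at h6
        linarith
      · intro e he
        rcases List.mem_cons.1 he with rfl | he
        · exact hcall
        · exact hI.isCall e he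
      · have h1 := hI.calls_le
        have h2 : r.2 ≤ 4 * callCost q (δ / alpha X) (i, Q) := hr3
        simp only [List.map_cons, List.sum_cons]
        omega

/-- The number of calls of Identify-Cover is `O(c² log n)`. -/
lemma trace_length_le {T : CoverTree X} {q xq : M} (hX : 2 ≤ X.card)
    (hnn : ∀ x ∈ X, dist q xq ≤ dist q x) {tr : List (ℤ × Finset M)}
    (hchain : tr.IsChain (Follows q (dist q xq))) (hcall : ∀ e ∈ tr, IsCall T q e) :
    (tr.length : ℝ) ≤
      25 * expansionConst (insert q (X : Set M)) ^ 2 * Real.log X.card := by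
  classical
  have hS : (insert q (X : Set M)).Finite := X.finite_toSet.insert q
  -- of an explicit node and its parent, one is at distance at least `2 ^ i / 4` from `q`
  have hzex : ∀ t : Fin tr.length, ∃ p ∈ tr[t].2, p ∉ T.level tr[t].1 ∧
      ∃ z ∈ tr[t].2, (2 : ℝ) ^ tr[t].1 / 4 ≤ dist q z := by
    intro t
    obtain ⟨p, hp, hpl, p', hp', h1, -⟩ := (hcall _ (List.getElem_mem t.2)).explicit
    refine ⟨p, hp, hpl, ?_⟩
    rw [zpow_sub_one₀ (by norm_num)] at h1
    have h2 := dist_triangle_left p p' q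
    rcases le_total (dist q p) (dist q p') with h | h
    · exact ⟨p', hp', by simp only [Fin.getElem_fin] at h1 ⊢; linarith⟩
    · exact ⟨p, hp, by simp only [Fin.getElem_fin] at h1 ⊢; linarith⟩
  choose p hp hpl z hz hzd using hzex
  rw [List.isChain_iff_getElem] at hchain
  have hXcall : ∀ t : Fin tr.length, ∀ x ∈ tr[t].2, x ∈ insert q (X : Set M) := fun t x hx =>
    Set.mem_insert_of_mem _
      (T.level_subset _ ((hcall _ (List.getElem_mem t.2)).subset hx))
  let a : ℕ → ℤ := fun t => if h : t < tr.length then tr[t].1 else 0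
  have ha : ∀ t (h : t < tr.length), a t = tr[t].1 := fun t h => dif_pos h
  let p₁ : ℕ → M := fun t => if h : t < tr.length then p ⟨t, h⟩ else q
  have hp₁ : ∀ t (h : t < tr.length), p₁ t = p ⟨t, h⟩ := fun t h => dif_pos h
  let z₁ : ℕ → M := fun t => if h : t < tr.length then z ⟨t, h⟩ else q
  have hz₁ : ∀ t (h : t < tr.length), z₁ t = z ⟨t, h⟩ := fun t h => dif_pos h
  have hmono : ∀ t, t + 1 < tr.length → a t < a (t + 1) := fun t ht => by
    rw [ha t (by omega), ha (t + 1) ht]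
    exact (hchain t ht).1
  have hmono' : ∀ t t', t < t' → t' < tr.length → a t < a t' := by
    intro t t' h
    induction t', h using Nat.le_induction with
    | base => exact hmono t
    | succ m hm ih => exact fun h' => (ih (by omega)).trans (hmono m h')
  -- the explicit node of the later call is no node of the level of an earlier call
  have hne : ∀ t t', t < t' → t' < tr.length → p₁ t ≠ p₁ t' := by
    intro t t' h h' he
    have hlt := hmono' t t' h h'
    rw [ha t (by omega), ha t' h'] at hlt
    rw [hp₁ t (by omega), hp₁ t' h'] at he
    refine hpl ⟨t, by omega⟩ ?_
    rw [he]
    exact T.level_anti (Int.le_sub_one_of_lt hlt)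
      ((hcall _ (List.getElem_mem h')).subset (hp ⟨t', h'⟩))
  refine length_le_of_annuli hS (Set.mem_insert q _) (r := dist q xq)
    (fun x hx hxne => hnn x (by simpa [hxne] using hx)) hX ?_ tr.length a p₁ z₁ hmono
    (fun t ht => ?_) (fun t ht => ?_) (fun t ht t' ht' he => ?_) (fun t ht => ?_)
    (fun t ht => ?_) (fun t ht => ?_)
  · refine (Set.ncard_insert_le _ _).trans ?_
    rw [Set.ncard_coe_finset]
  · rw [hp₁ t ht]; exact hXcall _ _ (hp _)
  · rw [hz₁ t ht]; exact hXcall _ _ (hz _)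
  · rcases lt_trichotomy t t' with h | h | h
    · exact absurd he (hne t t' h ht')
    · exact h
    · exact absurd he.symm (hne t' t h ht)
  · rw [ha t ht, hz₁ t ht]; exact hzd ⟨t, ht⟩
  · rw [ha (t + 1) ht, hp₁ t (by omega)]; exact (hchain t ht).2 _ (hp ⟨t, by omega⟩)
  · rw [ha (t + 1) ht, hz₁ t (by omega)]; exact (hchain t ht).2 _ (hz ⟨t, by omega⟩)

end Descent

/-! ### The number of queries in terms of `κ` -/

/-- The logarithmic factor of the query bound. -/
noncomputable def logFactor {M : Type u} (X : Finset M) (δ R : ℝ) : ℝ :=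
  Real.log (X.card / δ * Real.log (Real.exp 1 + R))

lemma one_le_logFactor {M : Type u} {X : Finset M} {δ R : ℝ}
    (hX : 2 ≤ X.card) (hδ : 0 < δ) (hδ2 : δ < 1 / 2) (hR : 0 ≤ R) :
    1 ≤ logFactor X δ R := by
  have h1 := one_le_log_exp_one_add hR
  have hX' : (2 : ℝ) ≤ X.card := by exact_mod_cast hX
  have h2 : 4 ≤ X.card / δ := by rw [le_div_iff₀ hδ]; linarith
  unfold logFactor
  rw [Real.le_log_iff_exp_le (by positivity)]
  have := Real.exp_one_lt_d9
  nlinarith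

section Kappa

variable {M : Type u} [MetricSpace M] {X : Finset M}

lemma inv_coverGap_sq_le_kappaTerm {q : M} {i : ℤ} {Q : Finset M} {j : M} (hj : j ∈ Q) :
    (coverGap (dist q) i Q j ^ 2)⁻¹ ≤ kappaTerm q i Q j := by
  have he : (0 : ℝ) < 2 ^ i := by positivity
  have hD : minOver Q (dist q) ≤ dist q j := minOver_le hj
  have h1 := le_max_left ((2 : ℝ) ^ i) (dist q j - minOver Q (dist q))
  have h2 := le_max_right ((2 : ℝ) ^ i) (dist q j - minOver Q (dist q))
  unfold kappaTerm
  have hpos := lt_of_lt_of_le he (le_max_right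
    (min |minOver Q (dist q) + (2 : ℝ) ^ i - dist q j|
      |dist q j + kappaMargin q i Q - minOver Q (dist q)|) ((2 : ℝ) ^ i))
  gcongr
  refine max_le ((min_le_left _ _).trans (abs_le.2 ⟨?_, ?_⟩)) h1
  · unfold coverGap; linarith
  · unfold coverGap; linarith

lemma kappaTerm_le {q : M} {i : ℤ} {Q : Finset M} {j : M} :
    kappaTerm q i Q j ≤ (((2 : ℝ) ^ i) ^ 2)⁻¹ := by
  unfold kappaTerm
  have he : (0 : ℝ) < 2 ^ i := by positivity
  gcongr
  exact le_max_right _ _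

lemma kappaTerm_nonneg {q : M} {i : ℤ} {Q : Finset M} {j : M} : 0 ≤ kappaTerm q i Q j := by
  unfold kappaTerm; positivity

/-- A call at level `i` has an explicit node within `2 ^ i` of its parent, so `d_min ≤ 2 ^ i`. -/
lemma inv_sq_zpow_le_worstGap {T : CoverTree X} {q xq xq' : M} {e : ℤ × Finset M}
    (h : IsCall T q e) : (((2 : ℝ) ^ e.1) ^ 2)⁻¹ ≤ worstGap X q xq xq' := by
  obtain ⟨p, hp, -, p', hp', h1, h2⟩ := h.explicit
  have hX : ∀ x ∈ e.2, x ∈ X := fun x hx => T.level_subset _ (h.subset hx)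
  have hne : p ≠ p' := by
    rintro rfl
    rw [dist_self] at h1
    exact absurd h1 (not_lt.2 (by positivity))
  have hsep : Set.infsep (X : Set M) ≤ 2 ^ e.1 :=
    (Set.infsep_le_dist_of_mem (hX p hp) (hX p' hp') hne).trans h2
  have hpos : 0 < Set.infsep (X : Set M) :=
    (Set.infsep_pos_iff_nontrivial_of_finite).2 ⟨p, hX p hp, p', hX p' hp', hne⟩
  refine le_trans ?_ (le_max_right _ _)
  gcongr

lemma kappaAvg_nonneg {q : M} {i : ℤ} {Q : Finset M} : 0 ≤ kappaAvg q i Q :=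
  div_nonneg (Finset.sum_nonneg fun _ _ => kappaTerm_nonneg) (Nat.cast_nonneg _)

lemma kappaAvg_le {T : CoverTree X} {q xq xq' : M} {e : ℤ × Finset M}
    (h : IsCall T q e) : kappaAvg q e.1 e.2 ≤ worstGap X q xq xq' := by
  have hc : (0 : ℝ) < e.2.card := by
    have := h.two_le_card
    exact_mod_cast (show 0 < e.2.card by omega)
  unfold kappaAvg
  rw [div_le_iff₀ hc]
  calc _ ≤ ∑ j ∈ e.2, worstGap X q xq xq' :=
        Finset.sum_le_sum fun j _ => kappaTerm_le.trans (inv_sq_zpow_le_worstGap h)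
    _ = _ := by rw [Finset.sum_const, nsmul_eq_mul, mul_comm]

lemma worstGap_nonneg {q xq xq' : M} : 0 ≤ worstGap X q xq xq' :=
  le_max_of_le_left (by positivity)

lemma kappaBar_le {T : CoverTree X} {q xq xq' : M} {tr : List (ℤ × Finset M)}
    (h : ∀ e ∈ tr, IsCall T q e) : kappaBar q tr ≤ worstGap X q xq xq' := by
  unfold kappaBar
  refine div_le_of_le_mul₀ (Nat.cast_nonneg _) worstGap_nonneg ?_
  have := List.sum_le_card_nsmul (tr.map (fun p => kappaAvg q p.1 p.2)) (worstGap X q xq xq')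
    (by
      intro x hx
      obtain ⟨e, he, rfl⟩ := List.mem_map.1 hx
      exact kappaAvg_le (h e he))
  rwa [List.length_map, nsmul_eq_mul, mul_comm] at this

lemma inv_gap_sq_le_worstGap {q xq xq' j : M} (h1 : dist q xq < dist q xq')
    (h2 : dist q xq' ≤ dist q j) : ((dist q xq - dist q j) ^ 2)⁻¹ ≤ worstGap X q xq xq' := by
  refine le_trans ?_ (le_max_left _ _)
  have : 0 < (dist q xq - dist q xq') ^ 2 := by
    have : dist q xq - dist q xq' ≠ 0 := by linarith
    positivity
  gcongr ?_⁻¹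
  nlinarith

open Classical in
lemma kappaFinal_le {q xq xq' : M} (h1 : dist q xq < dist q xq') {Q : Finset M}
    (h2 : ∀ j ∈ Q, j ≠ xq → dist q xq' ≤ dist q j) :
    kappaFinal q xq Q ≤ worstGap X q xq xq' := by
  unfold kappaFinal
  refine div_le_of_le_mul₀ (Nat.cast_nonneg _) worstGap_nonneg ?_
  calc _ ≤ ∑ j ∈ Q.erase xq, worstGap X q xq xq' := Finset.sum_le_sum fun j hj =>
        inv_gap_sq_le_worstGap h1 (h2 j (Finset.mem_of_mem_erase hj) (Finset.ne_of_mem_erase hj))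
    _ = (Q.erase xq).card * worstGap X q xq xq' := by rw [Finset.sum_const, nsmul_eq_mul]
    _ ≤ Q.card * worstGap X q xq xq' := by
        have := worstGap_nonneg (X := X) (q := q) (xq := xq) (xq' := xq')
        gcongr
        exact Finset.erase_subset _ _
    _ = _ := mul_comm _ _

lemma callCost_le {T : CoverTree X} {q xq xq' : M} {δ : ℝ} (hX : 2 ≤ X.card) (hδ : 0 < δ)
    (hδ2 : δ < 1 / 2) {e : ℤ × Finset M} (h : IsCall T q e) :
    (callCost q (δ / alpha X) e : ℝ) ≤ 130000 * logFactor X δ (worstGap X q xq xq') *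
      expansionConst (insert q (X : Set M)) ^ 9 * (1 + kappaAvg q e.1 e.2) := by
  set R := worstGap X q xq xq' with hR
  have hR0 : 0 ≤ R := worstGap_nonneg
  have hL := one_le_logFactor hX hδ hδ2 hR0
  obtain ⟨h0, h12⟩ := div_alpha_le hX hδ hδ2 h.two_le_card
  have hcard : (0 : ℝ) < e.2.card := by
    have := h.two_le_card
    exact_mod_cast (show 0 < e.2.card by omega)
  have hcardX : (e.2.card : ℝ) ≤ X.card := by
    exact_mod_cast Finset.card_le_card (h.subset.trans (T.level_subset _))
  have hterm : ∀ j ∈ e.2, (sampleBound (δ / alpha X / e.2.card)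
      (coverGap (dist q) e.1 e.2 j / 20) : ℝ) ≤
      130000 * logFactor X δ R * (1 + kappaTerm q e.1 e.2 j) := by
    intro j hj
    have hg : 0 < coverGap (dist q) e.1 e.2 j := coverGap_pos j
    have h1 : (coverGap (dist q) e.1 e.2 j ^ 2)⁻¹ ≤ (((2 : ℝ) ^ e.1) ^ 2)⁻¹ := by
      gcongr
      exact le_max_left _ _
    have h2 := sampleBound_le (δ' := δ / alpha X / e.2.card) hX hδ hδ2 (by
        rw [div_div]
        unfold alpha
        gcongr) h12 hg (h1.trans (inv_sq_zpow_le_worstGap h (xq := xq) (xq' := xq')))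
    refine h2.trans ?_
    have h3 := inv_coverGap_sq_le_kappaTerm (q := q) (i := e.1) hj
    change 130000 * _ * logFactor X δ R ≤ _
    rw [mul_right_comm]
    gcongr
  unfold callCost
  push_cast
  calc _ ≤ ∑ j ∈ e.2, 130000 * logFactor X δ R * (1 + kappaTerm q e.1 e.2 j) :=
        Finset.sum_le_sum hterm
    _ = 130000 * logFactor X δ R * e.2.card * (1 + kappaAvg q e.1 e.2) := by
        rw [← Finset.mul_sum, Finset.sum_add_distrib]
        unfold kappaAvg
        simp only [Finset.sum_const, nsmul_eq_mul, mul_one]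
        field_simp
    _ ≤ _ := by
        have h1 := h.card_le
        have h2 := kappaAvg_nonneg (q := q) (i := e.1) (Q := e.2)
        gcongr

lemma sum_callCost_le {T : CoverTree X} {q xq xq' : M} {δ : ℝ} (hX : 2 ≤ X.card) (hδ : 0 < δ)
    (hδ2 : δ < 1 / 2) {tr : List (ℤ × Finset M)} (h : ∀ e ∈ tr, IsCall T q e) :
    ((tr.map (callCost q (δ / alpha X))).sum : ℝ) ≤
      130000 * logFactor X δ (worstGap X q xq xq') *
      expansionConst (insert q (X : Set M)) ^ 9 * (tr.length * (1 + kappaBar q tr)) := by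
  -- for an empty trace both sides vanish, although `kappaBar` is then `0 / 0`
  have hlen : tr.length * (1 + kappaBar q tr) =
      tr.length + (tr.map (fun p => kappaAvg q p.1 p.2)).sum := by
    rcases eq_or_ne tr [] with rfl | hne
    · simp
    · have : (tr.length : ℝ) ≠ 0 := by simpa using hne
      unfold kappaBar
      field_simp
  rw [hlen]
  clear hlen
  induction tr with
  | nil => simp
  | cons e tr ih =>
    have h1 := ih fun e he => h e (List.mem_cons_of_mem _ he)
    have h2 := callCost_le (xq := xq) (xq' := xq') hX hδ hδ2 (h e List.mem_cons_self)
    simp only [List.map_cons, List.sum_cons, List.length_cons]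
    push_cast at h1 ⊢
    linarith

open Classical in
lemma sum_sampleBound_final_le {q xq xq' : M} {δ : ℝ} (hX : 2 ≤ X.card) (hδ : 0 < δ)
    (hδ2 : δ < 1 / 2) {Q : Finset M} (h1 : dist q xq < dist q xq')
    (h2 : ∀ j ∈ Q, j ≠ xq → dist q xq' ≤ dist q j) :
    ((∑ j ∈ Q.erase xq, sampleBound (δ / alpha X / X.card) ((dist q j - dist q xq) / 20) : ℕ) : ℝ)
      ≤ 130000 * logFactor X δ (worstGap X q xq xq') * (Q.card * (1 + kappaFinal q xq Q)) := by
  set R := worstGap X q xq xq' with hR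
  have hR0 : 0 ≤ R := worstGap_nonneg
  have hL := one_le_logFactor hX hδ hδ2 hR0
  obtain ⟨h0, h12⟩ := div_alpha_le hX hδ hδ2 hX
  have hterm : ∀ j ∈ Q.erase xq, (sampleBound (δ / alpha X / X.card)
      ((dist q j - dist q xq) / 20) : ℝ) ≤
      130000 * logFactor X δ R * (1 + ((dist q xq - dist q j) ^ 2)⁻¹) := by
    intro j hj
    have h3 := h2 j (Finset.mem_of_mem_erase hj) (Finset.ne_of_mem_erase hj)
    have e : (dist q j - dist q xq) ^ 2 = (dist q xq - dist q j) ^ 2 := by ring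
    have h4 := sampleBound_le (δ' := δ / alpha X / X.card) (g := dist q j - dist q xq) (R := R)
      hX hδ hδ2 (by rw [div_div]; rfl) h12 (by linarith)
      (by rw [e]; exact inv_gap_sq_le_worstGap h1 h3)
    refine h4.trans (le_of_eq ?_)
    rw [e, mul_right_comm]
    rfl
  push_cast
  calc _ ≤ ∑ j ∈ Q.erase xq,
        130000 * logFactor X δ R * (1 + ((dist q xq - dist q j) ^ 2)⁻¹) := Finset.sum_le_sum hterm
    _ = 130000 * logFactor X δ R * ((Q.erase xq).card +
          ∑ j ∈ Q.erase xq, ((dist q xq - dist q j) ^ 2)⁻¹) := by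
        rw [← Finset.mul_sum, Finset.sum_add_distrib]
        simp
    _ ≤ 130000 * logFactor X δ R * (Q.card + ∑ j ∈ Q.erase xq, ((dist q xq - dist q j) ^ 2)⁻¹) := by
        gcongr
        exact Finset.erase_subset _ _
    _ = _ := by
        congr 1
        rcases Q.eq_empty_or_nonempty with rfl | hne
        · simp
        · have : (Q.card : ℝ) ≠ 0 := by simpa using hne.ne_empty
          unfold kappaFinal
          field_simp

/-- On the event that all widths are valid the run of Noisy-Find-Nearest is correct and short. -/
lemma noisyFindNearest_spec {sel : Finset M → M} {T : CoverTree X} {δ : ℝ} {q xq xq' : M}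
    {y : ℕ → M → ℕ → ℝ} (hsel : ∀ S : Finset M, S.Nonempty → sel S ∈ S) (hX : 2 ≤ X.card)
    (hδ : 0 < δ) (hδ2 : δ < 1 / 2) (hxq : xq ∈ X) (hnn : ∀ x ∈ X, x ≠ xq → dist q xq < dist q x)
    (h1 : dist q xq < dist q xq') (h2 : ∀ j ∈ X, j ≠ xq → dist q xq' ≤ dist q j)
    (hgood : ∀ l < (T.top - T.bot).toNat, StageValid sel T δ q y l)
    (hlast : WidthsValid (δ / alpha X / X.card) X (y (T.top - T.bot).toNat) (dist q)) :
    ∃ r, noisyFindNearest sel T δ y = some r ∧ r.answer = xq ∧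
      (r.calls : ℝ) ≤ 30000000 * expansionConst (insert q (X : Set M)) ^ 17 * Real.log X.card *
        Real.log (X.card / δ * Real.log (Real.exp 1 + worstGap X q xq xq')) * kappa q xq r ∧
      kappa q xq r ≤ 1 * max 1 (worstGap X q xq xq') := by
  have hnn' : ∀ x ∈ X, dist q xq ≤ dist q x := fun x hx => by
    rcases eq_or_ne x xq with rfl | h
    · exact le_rfl
    · exact (hnn x hx h).le
  classical
  obtain ⟨s, hs, hI⟩ := exists_descentInv hsel hX hδ hδ2 hxq hnn' le_rfl hgood
  have hcX : s.cover ⊆ X := hI.subset.trans (T.level_subset _)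
  have hxc : xq ∈ s.cover := by
    have := hI.ancestor_mem
    rwa [Nat.sub_self, CoverTree.ancestor] at this
  obtain ⟨h0, h12⟩ := div_alpha_le hX hδ hδ2 hX
  obtain ⟨r, hr, hr1, hr2⟩ := findSmallest_spec hsel (hlast.mono hcX) h0 h12 hxc
    (fun j hj hne => hnn j (hcX hj) hne)
  refine ⟨⟨r.1, s.calls + r.2, s.trace, s.cover⟩, by simp [noisyFindNearest, hs, hr], hr1, ?_, ?_⟩
  · set κ := kappa q xq ⟨r.1, s.calls + r.2, s.trace, s.cover⟩ with hκ
    have hκ1 : 1 ≤ κ := le_max_left _ _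
    have hκb : kappaBar q s.trace ≤ κ := (le_max_left _ _).trans (le_max_right _ _)
    have hκf : kappaFinal q xq s.cover ≤ κ := (le_max_right _ _).trans (le_max_right _ _)
    have hS : (insert q (X : Set M)).Finite := X.finite_toSet.insert q
    have hc := two_le_expansionConst hS
    have hL := one_le_logFactor hX hδ hδ2
      (worstGap_nonneg (X := X) (q := q) (xq := xq) (xq' := xq'))
    have hlen := trace_length_le hX hnn' hI.chain hI.isCall
    have hcost := sum_callCost_le (xq := xq) (xq' := xq') hX hδ hδ2 hI.isCall
    have hfin := sum_sampleBound_final_le hX hδ hδ2 h1 (fun j hj => h2 j (hcX hj))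
    have hcalls := hI.calls_le
    have hcard := hI.card_le
    change _ ≤ _ * _ * _ * logFactor X δ (worstGap X q xq xq') * _
    set L := logFactor X δ (worstGap X q xq xq') with hLdef
    set c := expansionConst (insert q (X : Set M)) with hcdef
    have hlog : 2 / 3 ≤ Real.log X.card :=
      log_two_ge.trans (Real.log_le_log (by norm_num) (by exact_mod_cast hX))
    set ℓ := Real.log X.card with hℓ
    have hA : (s.calls : ℝ) ≤ 26000000 * (c ^ 11 * ℓ * L * κ) := by
      have e1 : (s.calls : ℝ) ≤ 4 * ((s.trace.map (callCost q (δ / alpha X))).sum : ℝ) := by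
        exact_mod_cast hcalls
      have e2 : s.trace.length * (1 + kappaBar q s.trace) ≤ (25 * c ^ 2 * ℓ) * (2 * κ) := by
        calc _ ≤ (s.trace.length : ℝ) * (2 * κ) := by gcongr; linarith
          _ ≤ _ := by gcongr
      have e3 : 130000 * L * c ^ 9 * (s.trace.length * (1 + kappaBar q s.trace)) ≤
          130000 * L * c ^ 9 * ((25 * c ^ 2 * ℓ) * (2 * κ)) := by gcongr
      calc _ ≤ 4 * (130000 * L * c ^ 9 * ((25 * c ^ 2 * ℓ) * (2 * κ))) := by linarith
        _ = _ := by ring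
    have hB : (r.2 : ℝ) ≤ 1 + 520000 * (c ^ 5 * L * κ) := by
      have e1 : (r.2 : ℝ) ≤ 1 + 2 * ((∑ j ∈ s.cover.erase xq, sampleBound (δ / alpha X / X.card)
          ((dist q j - dist q xq) / 20) : ℕ) : ℝ) := by exact_mod_cast hr2
      have e2 : s.cover.card * (1 + kappaFinal q xq s.cover) ≤ c ^ 5 * (2 * κ) := by
        calc _ ≤ (s.cover.card : ℝ) * (2 * κ) := by gcongr; linarith
          _ ≤ _ := by gcongr
      have e3 : 130000 * L * (s.cover.card * (1 + kappaFinal q xq s.cover)) ≤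
          130000 * L * (c ^ 5 * (2 * κ)) := by gcongr
      calc _ ≤ 1 + 2 * (130000 * L * (c ^ 5 * (2 * κ))) := by linarith
        _ = _ := by ring
    have hLκ : 1 ≤ L * κ := by nlinarith
    have h5 : c ^ 5 * L * κ ≤ 3 / 2 * (c ^ 17 * ℓ * L * κ) := by
      have : c ^ 5 ≤ c ^ 17 := pow_le_pow_right₀ (by linarith) (by norm_num)
      have : c ^ 5 * 1 ≤ c ^ 17 * (3 / 2 * ℓ) := by
        gcongr
        linarith
      calc c ^ 5 * L * κ = (c ^ 5 * 1) * (L * κ) := by ring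
        _ ≤ (c ^ 17 * (3 / 2 * ℓ)) * (L * κ) := by gcongr
        _ = _ := by ring
    have h11 : c ^ 11 * ℓ * L * κ ≤ c ^ 17 * ℓ * L * κ := by
      have : c ^ 11 ≤ c ^ 17 := pow_le_pow_right₀ (by linarith) (by norm_num)
      gcongr
    have hone : 1 ≤ c ^ 5 * L * κ := by
      have : 1 ≤ c ^ 5 := one_le_pow₀ (by linarith)
      nlinarith
    push_cast
    calc (s.calls : ℝ) + r.2 ≤ 30000000 * (c ^ 17 * ℓ * L * κ) := by linarith
      _ = _ := by ring
  · rw [one_mul]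
    refine max_le (le_max_left _ _) (max_le ?_ ?_)
    · exact (kappaBar_le hI.isCall).trans (le_max_right _ _)
    · exact (kappaFinal_le h1 fun j hj => h2 j (hcX hj)).trans (le_max_right _ _)

end Kappa

/-! ### Measurability of the search -/

/-- A map with countable range and measurable fibres: a random variable with values in a type
without a σ-algebra. -/
def IsDiscreteRV {Ω : Type v} (mΩ : MeasurableSpace Ω) {α : Type u} (f : Ω → α) : Prop :=
  (Set.range f).Countable ∧ ∀ a, MeasurableSet[mΩ] (f ⁻¹' {a})

section DiscreteRV

variable {Ω : Type v} {mΩ : MeasurableSpace Ω}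

lemma isDiscreteRV_const {α : Type u} (a : α) : IsDiscreteRV mΩ (fun _ : Ω => a) :=
  ⟨(Set.countable_singleton a).mono (by rintro _ ⟨_, rfl⟩; rfl), fun _ => MeasurableSet.const _⟩

/-- Measurable dependence on a discrete random variable need only be checked value by value. -/
lemma IsDiscreteRV.bind {α : Type*} {β : Type*} {f : Ω → α} {g : α → Ω → β}
    (hf : IsDiscreteRV mΩ f) (hg : ∀ ω, IsDiscreteRV mΩ (g (f ω))) :
    IsDiscreteRV mΩ (fun ω => g (f ω) ω) := by
  constructor
  · refine (hf.1.biUnion (t := fun a _ => Set.range (g a)) ?_).mono ?_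
    · rintro _ ⟨ω, rfl⟩
      exact (hg ω).1
    · rintro _ ⟨ω, rfl⟩
      exact Set.mem_biUnion ⟨ω, rfl⟩ ⟨ω, rfl⟩
  · intro b
    have : (fun ω => g (f ω) ω) ⁻¹' {b} = ⋃ a ∈ Set.range f, (f ⁻¹' {a}) ∩ (g a ⁻¹' {b}) := by
      ext ω
      simp only [Set.mem_preimage, Set.mem_singleton_iff, Set.mem_iUnion, Set.mem_inter_iff]
      exact ⟨fun h => ⟨_, ⟨ω, rfl⟩, rfl, h⟩, by rintro ⟨_, -, rfl, h⟩; exact h⟩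
    rw [this]
    refine MeasurableSet.biUnion hf.1 ?_
    rintro _ ⟨ω, rfl⟩
    exact (hf.2 _).inter ((hg ω).2 b)

lemma IsDiscreteRV.map {α : Type*} {β : Type*} {f : Ω → α} (hf : IsDiscreteRV mΩ f) (g : α → β) :
    IsDiscreteRV mΩ (fun ω => g (f ω)) :=
  hf.bind (g := fun a _ => g a) fun _ => isDiscreteRV_const _

lemma IsDiscreteRV.measurableSet {α : Type*} {f : Ω → α} (hf : IsDiscreteRV mΩ f)
    {p : α → Ω → Prop} (hp : ∀ ω, MeasurableSet {ω' | p (f ω) ω'}) :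
    MeasurableSet {ω | p (f ω) ω} := by
  have : {ω | p (f ω) ω} = ⋃ a ∈ Set.range f, (f ⁻¹' {a}) ∩ {ω | p a ω} := by
    ext ω
    simp only [Set.mem_preimage, Set.mem_singleton_iff, Set.mem_iUnion, Set.mem_inter_iff,
      Set.mem_ofPred_eq]
    exact ⟨fun h => ⟨_, ⟨ω, rfl⟩, rfl, h⟩, by rintro ⟨_, -, rfl, h⟩; exact h⟩
  rw [this]
  refine MeasurableSet.biUnion hf.1 ?_
  rintro _ ⟨ω, rfl⟩
  exact (hf.2 _).inter (hp ω)

lemma isDiscreteRV_filter {M : Type u} (Q : Finset M) (p : M → Ω → Prop)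
    [∀ ω, DecidablePred fun j => p j ω] (hp : ∀ j ∈ Q, MeasurableSet {ω | p j ω}) :
    IsDiscreteRV mΩ (fun ω => Q.filter (fun j => p j ω)) := by
  constructor
  · refine (Q.powerset.finite_toSet.countable).mono ?_
    rintro _ ⟨ω, rfl⟩
    exact Finset.mem_coe.2 (Finset.mem_powerset.2 (Finset.filter_subset _ _))
  · intro S
    by_cases hS : S ⊆ Q
    · have : (fun ω => Q.filter (fun j => p j ω)) ⁻¹' {S} = ⋂ j ∈ Q, {ω | p j ω ↔ j ∈ S} := by
        ext ω
        simp only [Set.mem_preimage, Set.mem_singleton_iff, Set.mem_iInter, Set.mem_ofPred_eq,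
          Finset.ext_iff, Finset.mem_filter]
        constructor
        · intro h j hj
          rw [← h j]
          simp [hj]
        · intro h j
          constructor
          · rintro ⟨h1, h2⟩
            exact (h j h1).1 h2
          · intro hjS
            exact ⟨hS hjS, (h j (hS hjS)).2 hjS⟩
      rw [this]
      refine Q.measurableSet_biInter fun j hj => ?_
      by_cases hjS : j ∈ S
      · simpa [hjS] using hp j hj
      · have : {ω | p j ω ↔ j ∈ S} = {ω | p j ω}ᶜ := by ext ω; simp [hjS]
        rw [this]
        exact (hp j hj).compl
    · have : (fun ω => Q.filter (fun j => p j ω)) ⁻¹' {S} = ∅ := by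
        ext ω
        simp only [Set.mem_preimage, Set.mem_singleton_iff, Set.mem_empty_iff_false, iff_false]
        rintro rfl
        exact hS (Finset.filter_subset _ _)
      rw [this]
      exact MeasurableSet.empty

lemma isDiscreteRV_iterate {σ : Type*} {step : Ω → σ → σ}
    (hstep : ∀ a, IsDiscreteRV mΩ (fun ω => step ω a)) (s : σ) (t : ℕ) :
    IsDiscreteRV mΩ (fun ω => (step ω)^[t] s) := by
  induction t with
  | zero => exact isDiscreteRV_const s
  | succ t ih =>
    simp_rw [Function.iterate_succ_apply']
    exact ih.bind (g := fun a ω => step ω a) fun _ => hstep _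

/-- The result of a loop is a random variable if the steps and the stopping rule are. -/
lemma isDiscreteRV_whileLoop {σ : Type u} {done : Ω → σ → Prop} {step : Ω → σ → σ}
    (hstep : ∀ a, IsDiscreteRV mΩ (fun ω => step ω a))
    (hdone : ∀ a, MeasurableSet {ω | done ω a}) (s : σ) :
    IsDiscreteRV mΩ (fun ω => whileLoop (done ω) (step ω) s) := by
  classical
  have hit := isDiscreteRV_iterate hstep s
  have hD : ∀ t : ℕ, MeasurableSet {ω | done ω ((step ω)^[t] s)} := fun t =>
    (hit t).measurableSet (p := fun a ω => done ω a) fun _ => hdone _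
  -- the number of rounds, `none` if the loop does not end
  let τ : Ω → Option ℕ := fun ω =>
    if h : ∃ t : ℕ, done ω ((step ω)^[t] s) then some (Nat.find h) else none
  have hτ : IsDiscreteRV mΩ τ := by
    refine ⟨Set.to_countable _, fun a => ?_⟩
    cases a with
    | none =>
      have : τ ⁻¹' {none} = ⋂ t : ℕ, {ω | done ω ((step ω)^[t] s)}ᶜ := by
        ext ω
        simp [τ]
      rw [this]
      exact MeasurableSet.iInter fun t => (hD t).compl
    | some n =>
      have : τ ⁻¹' {some n} = {ω | done ω ((step ω)^[n] s)} ∩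
          ⋂ t ∈ Finset.range n, {ω | done ω ((step ω)^[t] s)}ᶜ := by
        ext ω
        simp only [Set.mem_preimage, Set.mem_singleton_iff, Set.mem_inter_iff, Set.mem_iInter,
          Finset.mem_range, Set.mem_compl_iff, Set.mem_ofPred_eq]
        constructor
        · intro h
          by_cases hex : ∃ t : ℕ, done ω ((step ω)^[t] s)
          · simp only [τ, dif_pos hex, Option.some.injEq] at h
            exact (Nat.find_eq_iff hex).1 h
          · simp [τ, dif_neg hex] at h
        · intro h
          have hex : ∃ t : ℕ, done ω ((step ω)^[t] s) := ⟨n, h.1⟩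
          simp only [τ, dif_pos hex, Option.some.injEq]
          exact (Nat.find_eq_iff hex).2 h
      rw [this]
      exact (hD n).inter (Finset.measurableSet_biInter _ fun t _ => (hD t).compl)
  have heq : (fun ω => whileLoop (done ω) (step ω) s) =
      fun ω => (τ ω).map fun t => (step ω)^[t] s := by
    ext1 ω
    by_cases hex : ∃ t : ℕ, done ω ((step ω)^[t] s)
    · simp only [whileLoop, τ, dif_pos hex, Option.map_some]
    · simp only [whileLoop, τ, dif_neg hex, Option.map_none]
  rw [heq]
  refine hτ.bind (g := fun o ω => o.map fun t => (step ω)^[t] s) fun ω => ?_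
  cases τ ω with
  | none => exact isDiscreteRV_const _
  | some t => exact (hit t).map some

end DiscreteRV

section Search

variable {M : Type u} {Ω : Type v} {mΩ : MeasurableSpace Ω} {X : Finset M}

lemma measurable_minOver {Q : Finset M} {F : M → Ω → ℝ} (hF : ∀ j ∈ Q, Measurable (F j)) :
    Measurable (fun ω => minOver Q (fun j => F j ω)) := by
  rcases Q.eq_empty_or_nonempty with rfl | hQ
  · simp only [minOver, Finset.coe_empty, Set.image_empty]
    exact measurable_const
  · have : (fun ω => minOver Q (fun j => F j ω)) = Q.inf' hQ F := by
      ext ω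
      rw [Finset.inf'_apply, Finset.inf'_eq_csInf_image]
      rfl
    rw [this]
    exact Finset.inf'_induction hQ F (p := Measurable) (fun _ hf _ hg => hf.inf hg) hF

lemma measurable_empMean {y : M → ℕ → Ω → ℝ} (hy : ∀ x ∈ X, ∀ s, Measurable (y x s)) (T : M → ℕ)
    {j : M} (hj : j ∈ X) : Measurable (fun ω => empMean (fun x s => y x s ω) T j) :=
  (Finset.measurable_fun_sum _ fun s _ => hy j hj s).div_const _

lemma measurable_ucb {y : M → ℕ → Ω → ℝ} (hy : ∀ x ∈ X, ∀ s, Measurable (y x s)) (δ : ℝ)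
    (T : M → ℕ) {j : M} (hj : j ∈ X) : Measurable (fun ω => ucb δ (fun x s => y x s ω) T j) :=
  (measurable_empMean hy T hj).add_const _

lemma measurable_lcb {y : M → ℕ → Ω → ℝ} (hy : ∀ x ∈ X, ∀ s, Measurable (y x s)) (δ : ℝ)
    (T : M → ℕ) {j : M} (hj : j ∈ X) : Measurable (fun ω => lcb δ (fun x s => y x s ω) T j) :=
  (measurable_empMean hy T hj).sub_const _

lemma isDiscreteRV_argminSet {S : Finset M} {F : M → Ω → ℝ} (hF : ∀ j ∈ S, Measurable (F j)) :
    IsDiscreteRV mΩ (fun ω => argminSet S (fun j => F j ω)) := by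
  refine isDiscreteRV_filter S (fun j ω => ∀ k ∈ S, F j ω ≤ F k ω) fun j hj => ?_
  have : {ω | ∀ k ∈ S, F j ω ≤ F k ω} = ⋂ k ∈ S, {ω | F j ω ≤ F k ω} := by
    ext ω; simp
  rw [this]
  exact S.measurableSet_biInter fun k hk => measurableSet_le (hF j hj) (hF k hk)

lemma isDiscreteRV_argmaxSet {S : Finset M} {F : M → Ω → ℝ} (hF : ∀ j ∈ S, Measurable (F j)) :
    IsDiscreteRV mΩ (fun ω => argmaxSet S (fun j => F j ω)) :=
  isDiscreteRV_argminSet (F := fun j ω => -F j ω) fun j hj => (hF j hj).neg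

variable {y : M → ℕ → Ω → ℝ} (hy : ∀ x ∈ X, ∀ s, Measurable (y x s)) (sel : Finset M → M)
  (δ : ℝ) {Q : Finset M} (hQ : Q ⊆ X) (i : ℤ)

include hy hQ

lemma measurable_icLower (T : M → ℕ) :
    Measurable (fun ω => icLower δ Q i (fun x s => y x s ω) T) :=
  ((measurable_minOver fun _ hj => measurable_lcb hy _ T (hQ hj)).add_const _).add_const _

lemma measurable_icUpper (T : M → ℕ) :
    Measurable (fun ω => icUpper δ Q i (fun x s => y x s ω) T) :=
  (measurable_minOver fun _ hj => measurable_ucb hy _ T (hQ hj)).add_const _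

lemma isDiscreteRV_icKnown (T : M → ℕ) :
    IsDiscreteRV mΩ (fun ω => icKnown δ Q i (fun x s => y x s ω) T) :=
  isDiscreteRV_filter Q (fun j ω =>
    icUpper δ Q i (fun x s => y x s ω) T < lcb (δ / Q.card) (fun x s => y x s ω) T j ∨
      ucb (δ / Q.card) (fun x s => y x s ω) T j < icLower δ Q i (fun x s => y x s ω) T)
    fun _ hj => (measurableSet_lt (measurable_icUpper hy δ hQ i T)
      (measurable_lcb hy _ T (hQ hj))).union
      (measurableSet_lt (measurable_ucb hy _ T (hQ hj)) (measurable_icLower hy δ hQ i T))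

lemma isDiscreteRV_icEmpCover (T : M → ℕ) :
    IsDiscreteRV mΩ (fun ω => icEmpCover Q i (fun x s => y x s ω) T) :=
  isDiscreteRV_filter Q (fun j ω => empMean (fun x s => y x s ω) T j ≤
      minOver Q (empMean (fun x s => y x s ω) T) + (2 : ℝ) ^ i) fun _ hj => measurableSet_le
    (measurable_empMean hy T (hQ hj))
    ((measurable_minOver fun _ hk => measurable_empMean hy T (hQ hk)).add_const _)

lemma isDiscreteRV_icStep (T : M → ℕ) :
    IsDiscreteRV mΩ (fun ω => icStep sel δ Q i (fun x s => y x s ω) T) := by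
  classical
  refine (isDiscreteRV_icKnown hy δ hQ i T).bind (g := fun K ω =>
    pullFrom sel (argminSet Q (lcb (δ / Q.card) (fun x s => y x s ω) T))
      (pullFrom sel (argmaxSet ((Q \ icEmpCover Q i (fun x s => y x s ω) T) \ K)
        (lcb (δ / Q.card) (fun x s => y x s ω) T))
        (pullFrom sel (argminSet (icEmpCover Q i (fun x s => y x s ω) T \ K)
          (ucb (δ / Q.card) (fun x s => y x s ω) T)) T))) fun ω₁ => ?_
  refine (isDiscreteRV_icEmpCover hy hQ i T).bind (g := fun G ω =>
    pullFrom sel (argminSet Q (lcb (δ / Q.card) (fun x s => y x s ω) T))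
      (pullFrom sel (argmaxSet ((Q \ G) \ icKnown δ Q i (fun x s => y x s ω₁) T)
        (lcb (δ / Q.card) (fun x s => y x s ω) T))
        (pullFrom sel (argminSet (G \ icKnown δ Q i (fun x s => y x s ω₁) T)
          (ucb (δ / Q.card) (fun x s => y x s ω) T)) T))) fun ω₂ => ?_
  set K := icKnown δ Q i (fun x s => y x s ω₁) T
  have hGX : icEmpCover Q i (fun x s => y x s ω₂) T ⊆ X := (Finset.filter_subset _ _).trans hQ
  set G := icEmpCover Q i (fun x s => y x s ω₂) T
  have h1 : IsDiscreteRV mΩ fun ω => argminSet (G \ K)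
      (fun j => ucb (δ / Q.card) (fun x s => y x s ω) T j) :=
    isDiscreteRV_argminSet fun j hj => measurable_ucb hy _ T (hGX (Finset.mem_sdiff.1 hj).1)
  have h2 : IsDiscreteRV mΩ fun ω => argmaxSet ((Q \ G) \ K)
      (fun j => lcb (δ / Q.card) (fun x s => y x s ω) T j) :=
    isDiscreteRV_argmaxSet fun j hj =>
      measurable_lcb hy _ T (hQ (Finset.mem_sdiff.1 (Finset.mem_sdiff.1 hj).1).1)
  have h3 : IsDiscreteRV mΩ fun ω => argminSet Q
      (fun j => lcb (δ / Q.card) (fun x s => y x s ω) T j) :=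
    isDiscreteRV_argminSet fun j hj => measurable_lcb hy _ T (hQ hj)
  have h4 := h1.map fun S => pullFrom sel S T
  have h5 := h4.bind (g := fun T' ω => pullFrom sel (argmaxSet ((Q \ G) \ K)
      (fun j => lcb (δ / Q.card) (fun x s => y x s ω) T j)) T')
    fun _ => h2.map fun S => pullFrom sel S _
  exact h5.bind (g := fun T' ω => pullFrom sel (argminSet Q
      (fun j => lcb (δ / Q.card) (fun x s => y x s ω) T j)) T')
    fun _ => h3.map fun S => pullFrom sel S _

lemma isDiscreteRV_identifyCover :
    IsDiscreteRV mΩ (fun ω => identifyCover sel δ Q i (fun x s => y x s ω)) := by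
  classical
  have hloop : IsDiscreteRV mΩ (fun ω => whileLoop
      (fun T => icKnown δ Q i (fun x s => y x s ω) T = Q)
      (icStep sel δ Q i (fun x s => y x s ω)) (fun _ => 1)) :=
    isDiscreteRV_whileLoop (fun T => isDiscreteRV_icStep hy sel δ hQ i T)
      (fun T => (isDiscreteRV_icKnown hy δ hQ i T).2 Q) _
  refine hloop.bind (g := fun o ω => o.map fun T =>
    (Q.filter (fun j => ucb (δ / Q.card) (fun x s => y x s ω) T j <
      icLower δ Q i (fun x s => y x s ω) T), ∑ j ∈ Q, T j)) fun ω => ?_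
  cases whileLoop (fun T => icKnown δ Q i (fun x s => y x s ω) T = Q)
      (icStep sel δ Q i (fun x s => y x s ω)) (fun _ => 1) with
  | none => exact isDiscreteRV_const _
  | some T =>
    exact (isDiscreteRV_filter Q (fun j ω => ucb (δ / Q.card) (fun x s => y x s ω) T j <
      icLower δ Q i (fun x s => y x s ω) T) fun j hj =>
        measurableSet_lt (measurable_ucb hy _ T (hQ hj))
      (measurable_icLower hy δ hQ i T)).map fun S => some (S, ∑ j ∈ Q, T j)

end Search

section Descent

variable {M : Type u} [MetricSpace M] {X : Finset M} {Ω : Type v} {mΩ : MeasurableSpace Ω}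

/-- The state of the descent after `k` stages depends measurably on the answers in these stages. -/
lemma isDiscreteRV_descend (sel : Finset M → M) (T : CoverTree X) (δ : ℝ)
    {Y : ℕ → M → ℕ → Ω → ℝ} (k : ℕ) (hY : ∀ l < k, ∀ x ∈ X, ∀ s, Measurable (Y l x s)) :
    IsDiscreteRV mΩ (fun ω => descend sel T δ (fun l x s => Y l x s ω) k) := by
  classical
  induction k with
  | zero => exact isDiscreteRV_const _
  | succ k ih =>
    refine (ih fun l hl => hY l (by omega)).bind (g := fun o ω => o.bind fun s =>
      if T.childrenOf (T.top - k) s.cover = s.cover then some s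
      else (identifyCover sel (δ / alpha X) (T.childrenOf (T.top - k) s.cover) (T.top - k)
        (fun x t => Y k x t ω)).map fun r =>
          ⟨r.1, s.calls + r.2, (T.top - k, T.childrenOf (T.top - k) s.cover) :: s.trace⟩)
      fun ω => ?_
    cases descend sel T δ (fun l x s => Y l x s ω) k with
    | none => exact isDiscreteRV_const _
    | some s =>
      simp only [Option.bind_some]
      split_ifs with h
      · exact isDiscreteRV_const _
      · refine (isDiscreteRV_identifyCover (hY k (by omega)) sel (δ / alpha X) ?_
          (T.top - k)).map _
        exact fun p hp => T.level_subset _ (T.mem_childrenOf.1 hp).1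

/-- On every run the cover sets consist of nodes of the current level. -/
lemma descend_cover_subset {sel : Finset M → M} {T : CoverTree X} {δ : ℝ} {y : ℕ → M → ℕ → ℝ}
    {k : ℕ} {s : SearchState M} (hs : descend sel T δ y k = some s) :
    s.cover ⊆ T.level (T.top - k) := by
  classical
  induction k generalizing s with
  | zero =>
    simp only [descend, Option.some.injEq] at hs
    subst hs
    simp
  | succ k ih =>
    have hlev : T.top - ((k + 1 : ℕ) : ℤ) = T.top - k - 1 := by push_cast; ring
    rw [hlev]
    simp only [descend, Option.bind_eq_some_iff] at hs
    obtain ⟨s₀, hs₀, h⟩ := hs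
    have h0 := ih hs₀
    split_ifs at h with hc
    · simp only [Option.some.injEq] at h
      subst h
      exact h0.trans (T.nesting _)
    · simp only [Option.map_eq_some_iff, identifyCover] at h
      obtain ⟨_, ⟨T', -, rfl⟩, rfl⟩ := h
      exact (Finset.filter_subset _ _).trans fun p hp => (T.mem_childrenOf.1 hp).1

end Descent

/-! ### The probability that some width fails -/

section Algebra

variable {M : Type u} {X : Finset M} {Ω : Type v}

lemma measurableSet_widthsValid {mΩ : MeasurableSpace Ω} {y : M → ℕ → Ω → ℝ}
    (hy : ∀ x ∈ X, ∀ s, Measurable (y x s)) (δ : ℝ) {Q : Finset M} (hQ : Q ⊆ X) (d : M → ℝ) :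
    MeasurableSet {ω | WidthsValid δ Q (fun x s => y x s ω) d} := by
  have : {ω | WidthsValid δ Q (fun x s => y x s ω) d} = ⋂ j ∈ Q, ⋂ t : ℕ, ⋂ _ : 1 ≤ t,
      {ω | |(∑ s ∈ Finset.range t, y j s ω) / t - d j| ≤ confWidth δ t} := by
    ext ω
    simp [WidthsValid]
  rw [this]
  refine Q.measurableSet_biInter fun j hj => MeasurableSet.iInter fun t =>
    MeasurableSet.iInter fun _ => measurableSet_le ?_ measurable_const
  have h : ∀ s ∈ Finset.range t, Measurable (y j s) := fun s _ => hy j (hQ hj) s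
  exact (((Finset.measurable_fun_sum _ h).div_const _).sub_const _).abs

/-- The σ-algebra generated by the answers of the oracle in the stages `k ∈ K`. -/
abbrev stageAlgebra (X : Finset M) (Y : ℕ → M → ℕ → Ω → ℝ) (K : Set ℕ) : MeasurableSpace Ω :=
  ⨆ z ∈ {z : ℕ × {x // x ∈ X} × ℕ | z.1 ∈ K},
    MeasurableSpace.comap (Y z.1 z.2.1 z.2.2) inferInstance

lemma measurable_stageAlgebra {Y : ℕ → M → ℕ → Ω → ℝ} {K : Set ℕ} {l : ℕ} (hl : l ∈ K) {x : M}
    (hx : x ∈ X) (s : ℕ) : Measurable[stageAlgebra X Y K] (Y l x s) :=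
  measurable_iff_comap_le.2 (le_iSup₂_of_le
    (f := fun z (_ : z ∈ {z : ℕ × {x // x ∈ X} × ℕ | z.1 ∈ K}) =>
      MeasurableSpace.comap (Y z.1 z.2.1 z.2.2) inferInstance) (l, ⟨x, hx⟩, s) hl le_rfl)

lemma stageAlgebra_le {mΩ : MeasurableSpace Ω} {Y : ℕ → M → ℕ → Ω → ℝ}
    (hY : ∀ k, ∀ x ∈ X, ∀ s, Measurable (Y k x s)) (K : Set ℕ) : stageAlgebra X Y K ≤ mΩ :=
  iSup₂_le fun z _ => (hY z.1 z.2.1 z.2.1.2 z.2.2).comap_le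

/-- An event that depends on a discrete random variable `f` and on independent data is bounded by
its conditional probabilities given the values of `f`. -/
lemma measure_mem_le_of_indep {past now mΩ : MeasurableSpace Ω} {μ : @Measure Ω mΩ}
    (hμ : IsProbabilityMeasure μ) (hind : Indep past now μ) (hle : past ≤ mΩ) {α : Type u}
    {f : Ω → α} (hf : IsDiscreteRV past f) (B : α → Set Ω) (ε : ENNReal)
    (hB : ∀ ω, MeasurableSet[now] (B (f ω)) ∧ μ (B (f ω)) ≤ ε) :
    μ {ω | ω ∈ B (f ω)} ≤ ε := by
  have hsub : {ω | ω ∈ B (f ω)} ⊆ ⋃ o ∈ Set.range f, (f ⁻¹' {o}) ∩ B o := fun ω hω =>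
    Set.mem_biUnion ⟨ω, rfl⟩ ⟨rfl, hω⟩
  calc _ ≤ μ (⋃ o ∈ Set.range f, (f ⁻¹' {o}) ∩ B o) := measure_mono hsub
    _ ≤ ∑' o : Set.range f, μ ((f ⁻¹' {o.1}) ∩ B o.1) := measure_biUnion_le μ hf.1 _
    _ ≤ ∑' o : Set.range f, μ (f ⁻¹' {o.1}) * ε := by
        refine ENNReal.tsum_le_tsum ?_
        rintro ⟨_, ω, rfl⟩
        rw [(Indep_iff _ _ _).1 hind _ _ (hf.2 _) (hB ω).1]
        gcongr
        exact (hB ω).2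
    _ = (∑' o : Set.range f, μ (f ⁻¹' {o.1})) * ε := ENNReal.tsum_mul_right
    _ ≤ 1 * ε := by
        gcongr
        rw [← measure_biUnion hf.1 (fun a _ b _ hab => Set.disjoint_left.2 fun ω h1 h2 =>
          hab (h1.symm.trans h2)) fun o _ => hle _ (hf.2 o)]
        exact prob_le_one
    _ = ε := one_mul _

end Algebra

section Probability

variable {M : Type u} [MetricSpace M] {X : Finset M} {Ω : Type v}

lemma measure_not_widthsValid_le [MeasurableSpace Ω] {μ : Measure Ω} [IsProbabilityMeasure μ]
    {q : M} {Y : ℕ → M → ℕ → Ω → ℝ} (hO : IsDistanceOracle μ X q Y) {δ : ℝ} (hδ : 0 < δ)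
    (hδ' : δ ≤ 1 / 12) {Q : Finset M} (hQ : Q ⊆ X) (k : ℕ) :
    μ {ω | ¬ WidthsValid δ Q (fun x s => Y k x s ω) (dist q)} ≤ ENNReal.ofReal (Q.card * δ) := by
  have hsub : {ω | ¬ WidthsValid δ Q (fun x s => Y k x s ω) (dist q)} ⊆ ⋃ j ∈ Q, {ω | ∃ t : ℕ,
      1 ≤ t ∧ confWidth δ t < |(∑ s ∈ Finset.range t, Y k j s ω) / t - dist q j|} := by
    intro ω hω
    simp only [WidthsValid, Set.mem_ofPred_eq, not_forall, not_le] at hω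
    obtain ⟨j, hj, t, ht, h⟩ := hω
    exact Set.mem_biUnion hj ⟨t, ht, h⟩
  refine (measure_mono hsub).trans ((measure_biUnion_finset_le _ _).trans ?_)
  calc _ ≤ ∑ j ∈ Q, ENNReal.ofReal δ := Finset.sum_le_sum fun j hj =>
        measure_exists_abs_gt_confWidth (fun s => Y k j s) (dist q j)
          (hO.measurable k j (hQ hj))
          (hO.indep.precomp (g := fun s : ℕ => (k, (⟨j, hQ hj⟩ : {x // x ∈ X}), s))
            fun s s' h => by simpa using h)
          (hO.subGaussian k j (hQ hj)) hδ hδ'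
    _ = ENNReal.ofReal (Q.card * δ) := by
        rw [Finset.sum_const, nsmul_eq_mul, ENNReal.ofReal_mul (by positivity),
          ENNReal.ofReal_natCast]

/-- The event that a width fails in the call of Identify-Cover at stage `k` that starts from the
cover set `P`; it is empty if there is no such call. -/
def stageFailure (T : CoverTree X) (δ : ℝ) (q : M) (Y : ℕ → M → ℕ → Ω → ℝ) (k : ℕ)
    (P : Finset M) : Set Ω :=
  {ω | T.childrenOf (T.top - k) P ≠ P ∧
    ¬ WidthsValid (δ / alpha X / (T.childrenOf (T.top - k) P).card)
      (T.childrenOf (T.top - k) P) (fun x s => Y k x s ω) (dist q)}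

lemma measurableSet_stageFailure {mΩ : MeasurableSpace Ω} (T : CoverTree X) (δ : ℝ) (q : M)
    {Y : ℕ → M → ℕ → Ω → ℝ} {k : ℕ} (hY : ∀ x ∈ X, ∀ s, Measurable (Y k x s)) (P : Finset M) :
    MeasurableSet (stageFailure T δ q Y k P) :=
  (MeasurableSet.const _).inter (measurableSet_widthsValid hY _
    (fun _ hp => T.level_subset _ (T.mem_childrenOf.1 hp).1) _).compl

lemma measure_stageFailure_le {mΩ : MeasurableSpace Ω} {μ : Measure Ω} [IsProbabilityMeasure μ]
    {q : M} {Y : ℕ → M → ℕ → Ω → ℝ} (hO : IsDistanceOracle μ X q Y)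
    (T : CoverTree X) {δ : ℝ} (hX : 2 ≤ X.card) (hδ : 0 < δ) (hδ2 : δ < 1 / 2) {k : ℕ}
    {P : Finset M} (hP : P ⊆ T.level (T.top - k)) :
    μ (stageFailure T δ q Y k P) ≤ ENNReal.ofReal (δ / alpha X) := by
  by_cases hne : T.childrenOf (T.top - k) P = P
  · simp [stageFailure, hne]
  set Q := T.childrenOf (T.top - k) P with hQ
  have hQX : Q ⊆ X := fun p hp => T.level_subset _ (T.mem_childrenOf.1 hp).1
  obtain ⟨p, hp, -, p', hp', hlt, -⟩ := T.exists_explicit hP hne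
  have hcard : 2 ≤ Q.card := Finset.one_lt_card.2 ⟨p, hp, p', hp', by
    rintro rfl
    rw [dist_self] at hlt
    exact absurd hlt (not_lt.2 (by positivity))⟩
  obtain ⟨h0, h12⟩ := div_alpha_le hX hδ hδ2 hcard
  refine (measure_mono fun ω hω => hω.2).trans
    ((measure_not_widthsValid_le hO h0 h12 hQX k).trans (le_of_eq ?_))
  congr 1
  have : (Q.card : ℝ) ≠ 0 := by
    have : Q.card ≠ 0 := by omega
    exact_mod_cast this
  field_simp

lemma indep_stageAlgebra {mΩ : MeasurableSpace Ω} {μ : Measure Ω}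
    {q : M} {Y : ℕ → M → ℕ → Ω → ℝ} (hO : IsDistanceOracle μ X q Y) (k : ℕ) :
    Indep (stageAlgebra X Y (Set.Iio k)) (stageAlgebra X Y {k}) μ :=
  indep_iSup_of_disjoint
    (m := fun z : ℕ × {x // x ∈ X} × ℕ => MeasurableSpace.comap (Y z.1 z.2.1 z.2.2) inferInstance)
    (fun z => (hO.measurable z.1 z.2.1 z.2.1.2 z.2.2).comap_le) hO.indep
    (Set.disjoint_left.2 fun _ h1 h2 => (ne_of_lt h1) h2)

/-- The set of points passed to Identify-Cover at stage `k` is determined by the earlier stages,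
whose answers are independent of those at stage `k`, so that the failure probability can be
bounded for each possible set separately. -/
lemma measure_not_stageValid_le {mΩ : MeasurableSpace Ω} {μ : Measure Ω} [IsProbabilityMeasure μ]
    {q : M} {Y : ℕ → M → ℕ → Ω → ℝ} (hO : IsDistanceOracle μ X q Y) (sel : Finset M → M)
    (T : CoverTree X) {δ : ℝ} (hX : 2 ≤ X.card) (hδ : 0 < δ) (hδ2 : δ < 1 / 2) (k : ℕ) :
    μ {ω | ¬ StageValid sel T δ q (fun l x s => Y l x s ω) k} ≤ ENNReal.ofReal (δ / alpha X) := by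
  have hfd : IsDiscreteRV (stageAlgebra X Y (Set.Iio k))
      (fun ω => descend sel T δ (fun l x s => Y l x s ω) k) :=
    isDiscreteRV_descend (mΩ := stageAlgebra X Y (Set.Iio k)) sel T δ k
      fun l hl x hx s => measurable_stageAlgebra (K := Set.Iio k) (Set.mem_Iio.2 hl) hx s
  refine (measure_mono fun ω hω => ?_).trans
    (measure_mem_le_of_indep ‹_› (indep_stageAlgebra hO k) (stageAlgebra_le hO.measurable _) hfd
      (fun o => o.elim ∅ fun s => stageFailure T δ q Y k s.cover)
      (ENNReal.ofReal (δ / alpha X)) fun ω => ?_)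
  · by_contra h
    refine hω fun s hs hne => ?_
    by_contra hv
    apply h
    rw [Set.mem_ofPred_eq, hs]
    exact Set.mem_ofPred.2 ⟨hne, hv⟩
  · rcases hs : descend sel T δ (fun l x s => Y l x s ω) k with _ | s
    · exact ⟨@MeasurableSet.empty _ (stageAlgebra X Y {k}), by simp⟩
    · exact ⟨measurableSet_stageFailure (mΩ := stageAlgebra X Y {k}) T δ q
        (fun x hx s => measurable_stageAlgebra (Set.mem_singleton k) hx s) _,
        measure_stageFailure_le hO T hX hδ hδ2 (descend_cover_subset hs)⟩

/-- A level at which the set of nodes does not change needs no oracle calls. -/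
lemma stageValid_of_level_eq {sel : Finset M → M} {T : CoverTree X} {δ : ℝ} {q : M}
    {y : ℕ → M → ℕ → ℝ} {k : ℕ} (h : T.level (T.top - k - 1) = T.level (T.top - k)) :
    StageValid sel T δ q y k := by
  intro s hs hne
  obtain ⟨p, hp, hpl, -⟩ := T.exists_explicit (descend_cover_subset hs) hne
  exact absurd (h ▸ (T.mem_childrenOf.1 hp).1) hpl

open Classical in
lemma CoverTree.card_level_changes_lt (T : CoverTree X) (k : ℕ) :
    ((Finset.range k).filter
      fun l : ℕ => T.level (T.top - l - 1) ≠ T.level (T.top - l)).card <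
    (T.level (T.top - k)).card := by
  induction k with
  | zero =>
    obtain ⟨r, hr⟩ := T.level_top
    simp [hr]
  | succ k ih =>
    rw [Finset.range_add_one, Finset.filter_insert]
    have hlev : T.top - ((k + 1 : ℕ) : ℤ) = T.top - k - 1 := by push_cast; ring
    rw [hlev]
    split_ifs with h
    · refine (Finset.card_insert_le _ _).trans_lt ?_
      have := Finset.card_lt_card ((T.nesting (T.top - k)).ssubset_of_ne (Ne.symm h))
      omega
    · exact ih.trans_le (Finset.card_le_card (T.nesting _))

/-- All widths of a run are valid with probability at least `1 - δ`: at most `n - 1` stages call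
Identify-Cover, and each of them, like the final subroutine, fails with probability at most
`δ / (n + 1)`. -/
lemma measure_valid_ge [MeasurableSpace Ω] {μ : Measure Ω} [IsProbabilityMeasure μ]
    {q : M} {Y : ℕ → M → ℕ → Ω → ℝ} (hO : IsDistanceOracle μ X q Y) (sel : Finset M → M)
    (T : CoverTree X) {δ : ℝ} (hX : 2 ≤ X.card) (hδ : 0 < δ) (hδ2 : δ < 1 / 2) :
    ENNReal.ofReal (1 - δ) ≤ μ {ω | (∀ l < (T.top - T.bot).toNat,
        StageValid sel T δ q (fun k x s => Y k x s ω) l) ∧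
      WidthsValid (δ / alpha X / X.card) X (fun x s => Y (T.top - T.bot).toNat x s ω)
        (dist q)} := by
  classical
  set h := (T.top - T.bot).toNat with hh
  have htb := T.bot_le_top
  set G := {ω | (∀ l < h, StageValid sel T δ q (fun k x s => Y k x s ω) l) ∧
      WidthsValid (δ / alpha X / X.card) X (fun x s => Y h x s ω) (dist q)} with hG
  set C := (Finset.range h).filter
    fun l : ℕ => T.level (T.top - l - 1) ≠ T.level (T.top - l) with hC
  obtain ⟨h0, h12⟩ := div_alpha_le hX hδ hδ2 hX
  have hα : 0 < alpha X := by unfold alpha; positivity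
  have hX0 : (0 : ℝ) < X.card := by exact_mod_cast (show 0 < X.card by omega)
  have hcover : (Set.univ : Set Ω) ⊆ G ∪
      ((⋃ l ∈ C, {ω | ¬ StageValid sel T δ q (fun k x s => Y k x s ω) l}) ∪
      {ω | ¬ WidthsValid (δ / alpha X / X.card) X (fun x s => Y h x s ω) (dist q)}) := by
    intro ω _
    by_contra hno
    simp only [Set.mem_union, not_or, Set.mem_iUnion, not_exists, Set.mem_ofPred_eq,
      not_not] at hno
    refine hno.1 ⟨fun l hl => ?_, hno.2.2⟩
    by_cases hlC : l ∈ C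
    · exact hno.2.1 l hlC
    · rw [hC, Finset.mem_filter, not_and, not_not] at hlC
      exact stageValid_of_level_eq (hlC (Finset.mem_range.2 hl))
  have hCcard : (C.card : ℝ) + 1 ≤ X.card := by
    have := T.card_level_changes_lt h
    rw [show T.top - (h : ℤ) = T.bot by omega, T.level_bot] at this
    exact_mod_cast this
  have hbad : μ ((⋃ l ∈ C, {ω | ¬ StageValid sel T δ q (fun k x s => Y k x s ω) l}) ∪
      {ω | ¬ WidthsValid (δ / alpha X / X.card) X (fun x s => Y h x s ω) (dist q)}) ≤
      ENNReal.ofReal δ := by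
    have h1 : μ (⋃ l ∈ C, {ω | ¬ StageValid sel T δ q (fun k x s => Y k x s ω) l}) ≤
        ENNReal.ofReal (C.card * (δ / alpha X)) := by
      refine (measure_biUnion_finset_le _ _).trans ?_
      refine (Finset.sum_le_sum fun l _ =>
        measure_not_stageValid_le hO sel T hX hδ hδ2 l).trans (le_of_eq ?_)
      rw [Finset.sum_const, nsmul_eq_mul, ENNReal.ofReal_mul (by positivity),
        ENNReal.ofReal_natCast]
    have h2 := measure_not_widthsValid_le hO h0 h12 (Finset.Subset.refl X) h
    refine (measure_union_le _ _).trans ((add_le_add h1 h2).trans ?_)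
    rw [← ENNReal.ofReal_add (by positivity) (by positivity)]
    refine ENNReal.ofReal_le_ofReal ?_
    have e : (X.card : ℝ) * (δ / alpha X / X.card) = δ / alpha X := by field_simp
    rw [e]
    have e2 : δ / alpha X * alpha X = δ := by field_simp
    have h3 : 0 < δ / alpha X := by positivity
    have h4 : (C.card : ℝ) + 1 ≤ alpha X := by unfold alpha; linarith
    nlinarith
  have huniv := (measure_mono hcover).trans (measure_union_le (μ := μ) _ _)
  rw [measure_univ] at huniv
  rw [ENNReal.ofReal_sub _ hδ.le, ENNReal.ofReal_one]
  exact tsub_le_iff_right.2 (huniv.trans (by gcongr))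

end Probability

end BanditCoverTree

theorem mainTheorem1 :
    ∃ A B : ℝ, 0 < A ∧ 0 < B ∧
      ∀ (M : Type u) [MetricSpace M] (X : Finset M) (T : BanditCoverTree.CoverTree X)
        (q xq xq' : M) (δ : ℝ) (sel : Finset M → M)
        (Ω : Type v) [MeasurableSpace Ω] (μ : Measure Ω) [IsProbabilityMeasure μ]
        (Y : ℕ → M → ℕ → Ω → ℝ),
        0 < δ → δ < 1 / 2 →
        -- `xq` is the nearest neighbour of `q` in `X` and `xq'` the second nearest one
        xq ∈ X → (∀ x ∈ X, x ≠ xq → dist q xq < dist q x) →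
        xq' ∈ X → xq' ≠ xq → (∀ x ∈ X, x ≠ xq → dist q xq' ≤ dist q x) →
        -- `sel` is the tie-breaking rule
        (∀ S : Finset M, S.Nonempty → sel S ∈ S) →
        BanditCoverTree.IsDistanceOracle μ X q Y →
        ENNReal.ofReal (1 - δ) ≤ μ {ω | ∃ r : BanditCoverTree.SearchResult M,
          BanditCoverTree.noisyFindNearest sel T δ (fun k x s => Y k x s ω) = some r ∧
          r.answer = xq ∧
          (r.calls : ℝ) ≤ A * BanditCoverTree.expansionConst (insert q (X : Set M)) ^ 17 *
            Real.log X.card *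
            Real.log (X.card / δ *
              Real.log (Real.exp 1 + BanditCoverTree.worstGap X q xq xq')) *
            BanditCoverTree.kappa q xq r ∧
          BanditCoverTree.kappa q xq r ≤
            B * max 1 (BanditCoverTree.worstGap X q xq xq')} := by
  refine ⟨30000000, 1, by norm_num, one_pos, ?_⟩
  intro M _ X T q xq xq' δ sel Ω _ μ _ Y hδ hδ2 hxq hnn hxq' hne hsnd hsel hO
  have hX : 2 ≤ X.card := Finset.one_lt_card.2 ⟨xq', hxq', xq, hxq, hne⟩
  refine (BanditCoverTree.measure_valid_ge hO sel T hX hδ hδ2).trans (measure_mono ?_)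
  rintro ω ⟨hstages, hlast⟩
  exact BanditCoverTree.noisyFindNearest_spec hsel hX hδ hδ2 hxq hnn (hnn xq' hxq' hne) hsnd
    hstages hlast
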